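/- Let $n\ge 1$ and let $\mathbb H^n=\mathbb C^n\times\mathbb R$ be the Heisenberg group with the group law $(z,t)(w,s)=\big(z+w,\,t+s+\tfrac12\Im(z\cdot\bar w)\big)$, inverse $(w,s)^{-1}=(-w,-s)$ and Haar measure $dz\,dt$ (Lebesgue measure). For $k\in\mathbb N=\{0,1,2,\dots\}$ and $\lambda\in\mathbb R\setminus\{0\}$ put $$\varphi^{n-1}_{k,\lambda}(z)=L^{n-1}_k\big(\tfrac12|\lambda||z|^2\big)e^{-\frac14|\lambda||z|^2},\qquad e^{n-1}_{k,\lambda}(z,t)=e^{i\lambda t}\varphi^{n-1}_{k,\lambda}(z),$$ where $L_k^{n-1}$ is the Laguerre polynomial of type $n-1$. Let $\Omega\subset\mathbb R^2$ be the Heisenberg fan, the union of the rays $R_k=\{(\lambda,\tau):\tau=(2k+n)|\lambda|\}$, $k\in\mathbb N$, and the limiting ray $R_\infty=\{(0,\tau):\tau\ge 0\}$, with the measure $\nu$ given by $$\int_\Omega\psi\,d\nu=(2\pi)^{-2n-1}\int_{-\infty}^\infty\Big(\sum_{k=0}^\infty\psi\big(\lambda,(2k+n)|\lambda|\big)\Big)|\lambda|^{2n}\,d\lambda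 .$$ The Strichartz Fourier transform of $f\in L^1\cap L^2(\mathbb H^n)$ is the function on $\Omega\times\mathbb C^n$ given for $a=(\lambda,(2k+n)|\lambda|)\in R_k$, $\lambda\ne0$, by $$\widehat f(a,z)=\int_{\mathbb H^n}f(w,s)\,e^{n-1}_{k,\lambda}\big((w,s)^{-1}(z,0)\big)\,dw\,ds,$$ for $a=(0,\tau)$, $\tau>0$, by $$\widehat f(a,z)=(n-1)!\,2^{n-1}\int_{\mathbb H^n}f(w,s)\,\frac{J_{n-1}(\sqrt\tau|z-w|)}{(\sqrt\tau|z-w|)^{n-1}}\,dw\,ds,$$ with $J_{n-1}$ the Bessel function of order $n-1$, and for $a=(0,0)$ by $\widehat f(a,z)=\int_{\mathbb H^n}f(w,s)\,dw\,ds$. Write $$g\ast_\lambda h(z)=\int_{\mathbb C^n}g(z-w)\,h(w)\,e^{\frac i2\lambda\Im(z\cdot\bar w)}\,dw$$ for the $\lambda$-twisted convolution, and let $L^2_0(\Omega\times\mathbb C^n,d\nu\,dw)$ be the set of all $F\in L^2(\Omega\times\mathbb C^n,d\nu\,dw)$ such that, for $\nu$-almost every $a=(\lambda,(2k+n)|\lambda|)\in\Omega$,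 $$(2\pi)^{-n}|\lambda|^n\,\varphi^{n-1}_{k,\lambda}\ast_\lambda F(a,\cdot)(z)=F(a,z)\qquad\text{for almost every }z\in\mathbb C^n.$$ **Theorem.** $L^2_0(\Omega\times\mathbb C^n,d\nu\,dw)$ is a closed linear subspace of $L^2(\Omega\times\mathbb C^n,d\nu\,dw)$, and the Strichartz Fourier transform $f\mapsto\widehat f$, initially defined on $L^1\cap L^2(\mathbb H^n)$, extends to a unitary operator from $L^2(\mathbb H^n)$ onto $L^2_0(\Omega\times\mathbb C^n,d\nu\,dw)$. -/

import Mathlib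

open MeasureTheory

/-- The underlying space `ℂⁿ × ℝ` of the Heisenberg group `ℍⁿ`. Its `volume` is Lebesgue measure
`dz dt`, the Haar measure of `ℍⁿ`. The group law is `heisMul` below. (The sup norm that Mathlib
puts on `Fin n → ℂ` is never used; `|z|²` is `normSqC z`.) -/
abbrev Heis (n : ℕ) : Type := (Fin n → ℂ) × ℝ

/-- `|z|² = ∑ |z_j|²` for `z ∈ ℂⁿ`. -/
noncomputable def normSqC {n : ℕ} (z : Fin n → ℂ) : ℝ := ∑ j, ‖z j‖ ^ 2

/-- `Im (z · w̄)` for `z, w ∈ ℂⁿ`. -/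
noncomputable def imDot {n : ℕ} (z w : Fin n → ℂ) : ℝ :=
  (∑ j, z j * (starRingEnd ℂ) (w j)).im

/-- The group law `(z,t)(w,s) = (z + w, t + s + ½ Im (z · w̄))` of the Heisenberg group. -/
noncomputable def heisMul {n : ℕ} (p q : Heis n) : Heis n :=
  (p.1 + q.1, p.2 + q.2 + (1 / 2) * imDot p.1 q.1)

/-- The inverse `(z,t)⁻¹ = (-z,-t)` in the Heisenberg group. -/
def heisInv {n : ℕ} (p : Heis n) : Heis n := (-p.1, -p.2)

/-- The Laguerre polynomial `L_k^m(x) = ∑_{i ≤ k} (-1)^i binom(k+m, k-i) x^i / i!`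
of (integer) type `m`. -/
noncomputable def laguerreL (m k : ℕ) (x : ℝ) : ℝ :=
  ∑ i ∈ Finset.range (k + 1),
    (-1 : ℝ) ^ i * ((k + m).choose (k - i) : ℝ) * x ^ i / (i.factorial : ℝ)

/-- The Bessel function `J_m(x) = ∑_j (-1)^j / (j! (j+m)!) (x/2)^(2j+m)` of integer order `m`. -/
noncomputable def besselJ (m : ℕ) (x : ℝ) : ℝ :=
  ∑' j : ℕ, (-1 : ℝ) ^ j / ((j.factorial : ℝ) * ((j + m).factorial : ℝ)) * (x / 2) ^ (2 * j + m)

/-- The Laguerre function `φ_{k,λ}^{n-1}(z) = L_k^{n-1}(½|λ||z|²) exp(-¼|λ||z|²)` on `ℂⁿ`. -/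
noncomputable def laguerreFun (n k : ℕ) (lam : ℝ) (z : Fin n → ℂ) : ℝ :=
  laguerreL (n - 1) k ((1 / 2) * |lam| * normSqC z) * Real.exp (-((1 / 4) * |lam| * normSqC z))

/-- The function `e_{k,λ}^{n-1}(z,t) = exp(iλt) φ_{k,λ}^{n-1}(z)` on `ℍⁿ`. -/
noncomputable def heisE (n k : ℕ) (lam : ℝ) (p : Heis n) : ℂ :=
  Complex.exp (Complex.I * lam * p.2) * (laguerreFun n k lam p.1 : ℂ)

/-- The `λ`-twisted convolution `f *_λ g (z) = ∫ f(z-w) g(w) exp((i/2) λ Im (z · w̄)) dw`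
on `ℂⁿ`. -/
noncomputable def twistedConv {n : ℕ} (lam : ℝ) (f g : (Fin n → ℂ) → ℂ) (z : Fin n → ℂ) : ℂ :=
  ∫ w : Fin n → ℂ, f (z - w) * g w * Complex.exp (Complex.I / 2 * lam * imDot z w)

/-- The ray `R_k = {(λ,τ) : τ = (2k+n)|λ|}`. -/
def fanRay (n k : ℕ) : Set (ℝ × ℝ) := {a | a.2 = (2 * k + n) * |a.1|}

/-- The limiting ray `R_∞ = {(0,τ) : τ ≥ 0}`. -/
def limitRay : Set (ℝ × ℝ) := {a | a.1 = 0 ∧ 0 ≤ a.2}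

/-- The Heisenberg fan `Ω ⊆ ℝ²`, the union of the rays `R_k` and of the limiting ray. -/
def heisFan (n : ℕ) : Set (ℝ × ℝ) := (⋃ k : ℕ, fanRay n k) ∪ limitRay

/-- The point `(λ, (2k+n)|λ|)` of `R_k ⊆ Ω`. -/
def fanPoint (n k : ℕ) (lam : ℝ) : heisFan n :=
  ⟨(lam, (2 * k + n) * |lam|), Or.inl (Set.mem_iUnion.2 ⟨k, rfl⟩)⟩

/-- For `a = (λ,τ) ∈ Ω` with `λ ≠ 0`, the unique `k` with `a ∈ R_k` (see `fanIndex_fanPoint`). -/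
noncomputable def fanIndex {n : ℕ} (a : heisFan n) : ℕ := sInf {k : ℕ | (a : ℝ × ℝ) ∈ fanRay n k}

theorem fanIndex_fanPoint (n k : ℕ) {lam : ℝ} (h : lam ≠ 0) : fanIndex (fanPoint n k lam) = k := by
  have : {j : ℕ | (fanPoint n k lam : ℝ × ℝ) ∈ fanRay n j} = {k} := by
    ext j
    simp only [fanPoint, fanRay, Set.mem_ofPred_eq, Set.mem_singleton_iff]
    constructor
    · intro hj
      have h2 := mul_right_cancel₀ (abs_ne_zero.2 h) hj
      have h3 : (k : ℝ) = j := by linarith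
      exact (by exact_mod_cast h3.symm)
    · rintro rfl
      rfl
  rw [fanIndex, this, csInf_singleton]

/-- The measure `ν` on `Ω`:
`∫ φ dν = (2π)^(-2n-1) ∫ (∑_k φ(λ, (2k+n)|λ|)) |λ|^(2n) dλ` (see `lintegral_fanMeasure`). -/
noncomputable def fanMeasure (n : ℕ) : Measure (heisFan n) :=
  Measure.sum fun k : ℕ => Measure.map (fanPoint n k)
    ((volume : Measure ℝ).withDensity fun lam =>
      ENNReal.ofReal (((2 * Real.pi) ^ (2 * n + 1))⁻¹ * |lam| ^ (2 * n)))

theorem measurable_fanPoint (n k : ℕ) : Measurable (fanPoint n k) := by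
  refine Measurable.subtype_mk ?_
  fun_prop

theorem lintegral_fanMeasure (n : ℕ) {φ : heisFan n → ENNReal} (hφ : Measurable φ) :
    ∫⁻ a, φ a ∂(fanMeasure n) = ENNReal.ofReal (((2 * Real.pi) ^ (2 * n + 1))⁻¹) *
      ∫⁻ lam : ℝ, (∑' k : ℕ, φ (fanPoint n k lam)) * ENNReal.ofReal (|lam| ^ (2 * n)) := by
  have hm : ∀ k, Measurable fun lam => φ (fanPoint n k lam) :=
    fun k => hφ.comp (measurable_fanPoint n k)
  have hs : Measurable fun lam : ℝ =>
      (∑' k : ℕ, φ (fanPoint n k lam)) * ENNReal.ofReal (|lam| ^ (2 * n)) :=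
    (Measurable.tsum hm).mul (by fun_prop)
  rw [fanMeasure, lintegral_sum_measure, ← lintegral_const_mul _ hs]
  have : ∀ lam : ℝ, ENNReal.ofReal (((2 * Real.pi) ^ (2 * n + 1))⁻¹) *
      ((∑' k : ℕ, φ (fanPoint n k lam)) * ENNReal.ofReal (|lam| ^ (2 * n))) =
      ∑' k : ℕ, ENNReal.ofReal (((2 * Real.pi) ^ (2 * n + 1))⁻¹ * |lam| ^ (2 * n)) *
        φ (fanPoint n k lam) := by
    intro lam
    rw [ENNReal.tsum_mul_left, ENNReal.ofReal_mul (by positivity)]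
    ring
  simp_rw [this]
  have hd : Measurable fun lam : ℝ =>
      ENNReal.ofReal (((2 * Real.pi) ^ (2 * n + 1))⁻¹ * |lam| ^ (2 * n)) := by fun_prop
  refine Eq.trans (tsum_congr fun k => ?_)
    (lintegral_tsum (fun k => (hd.mul (hm k)).aemeasurable)).symm
  rw [lintegral_map hφ (measurable_fanPoint n k),
    lintegral_withDensity_eq_lintegral_mul _ (by fun_prop) (hm k)]

instance instSFiniteFanMeasure (n : ℕ) : SFinite (fanMeasure n) := by
  unfold fanMeasure
  infer_instance

theorem ae_fan_ne_zero (n : ℕ) : ∀ᵐ a ∂(fanMeasure n), a.1.1 ≠ 0 := by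
  have hs : MeasurableSet {a : heisFan n | a.1.1 ≠ 0} :=
    (measurable_fst.comp measurable_subtype_coe) (measurableSet_singleton (0 : ℝ)).compl
  rw [fanMeasure, Measure.ae_sum_iff' hs]
  intro k
  rw [ae_map_iff (measurable_fanPoint n k).aemeasurable hs]
  exact (withDensity_absolutelyContinuous _ _).ae_le
    ((measure_eq_zero_iff_ae_notMem.1 (Real.volume_singleton (a := 0))))

/-- The Strichartz Fourier transform `f̂(a,z)`, `(a,z) ∈ Ω × ℂⁿ`, of a function on `ℍⁿ`.
For `a = (λ,(2k+n)|λ|) ∈ R_k`, `λ ≠ 0`, it is `∫ f(w,s) e_a((w,s)⁻¹(z,0)) dw ds`; on the limiting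
ray it is given by the Bessel function `J_{n-1}`, with the value `∫ f` at the origin. -/
noncomputable def strichartzFT (n : ℕ) (f : Heis n → ℂ) (a : heisFan n) (z : Fin n → ℂ) : ℂ :=
  open scoped Classical in
  if a.1.1 ≠ 0 then
    ∫ p : Heis n, f p * heisE n (fanIndex a) a.1.1 (heisMul (heisInv p) (z, 0))
  else if a.1.2 = 0 then
    ∫ p : Heis n, f p
  else
    ((n - 1).factorial : ℂ) * 2 ^ (n - 1) * ∫ p : Heis n, f p *
      ((besselJ (n - 1) (√a.1.2 * √(normSqC (z - p.1))) /
        (√a.1.2 * √(normSqC (z - p.1))) ^ (n - 1) : ℝ) : ℂ)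

/-- `L²(ℍⁿ)`. -/
abbrev L2Heis (n : ℕ) : Type := Lp ℂ 2 (volume : Measure (Heis n))

/-- `L²(Ω × ℂⁿ, dν dw)`. -/
abbrev L2Fan (n : ℕ) : Type :=
  Lp ℂ 2 ((fanMeasure n).prod (volume : Measure (Fin n → ℂ)))

/-- The operator `g ↦ (2π)^(-n) |λ|^n φ_{k,λ}^{n-1} *_λ g` attached to `a = (λ,(2k+n)|λ|) ∈ R_k`,
`λ ≠ 0`. -/
noncomputable def fanRepro {n : ℕ} (a : heisFan n) (g : (Fin n → ℂ) → ℂ) (z : Fin n → ℂ) : ℂ :=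
  ((((2 * Real.pi) ^ n)⁻¹ * |a.1.1| ^ n : ℝ) : ℂ) *
    twistedConv a.1.1
      (fun w => (laguerreFun n (fanIndex a) a.1.1 w : ℂ)) g z

theorem continuous_laguerreFun (n k : ℕ) (lam : ℝ) : Continuous (laguerreFun n k lam) := by
  unfold laguerreFun laguerreL normSqC
  fun_prop

theorem memLp_gaussian_mul_pow (n i : ℕ) {c : ℝ} (hc : 0 < c) :
    MemLp (fun w : Fin n → ℂ => normSqC w ^ i * Real.exp (-(c * normSqC w))) 2 volume := by
  have hcont : Continuous fun w : Fin n → ℂ => normSqC w ^ i * Real.exp (-(c * normSqC w)) := by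
    unfold normSqC
    fun_prop
  refine (memLp_two_iff_integrable_sq hcont.aestronglyMeasurable).2 ?_
  have hg1 : Integrable fun w : ℂ => Real.exp (-(c * ‖w‖ ^ 2)) := by
    have := (GaussianFourier.integrable_cexp_neg_mul_sq_norm_add (V := ℂ) (b := (c : ℂ))
      (by simpa using hc) 0 0).norm
    refine this.congr (Filter.Eventually.of_forall fun w => ?_)
    simp [Complex.norm_exp, ← Complex.ofReal_pow]
  have hg : Integrable fun w : Fin n → ℂ => Real.exp (-(c * normSqC w)) := by
    have := Integrable.fintype_prod (ι := Fin n) (f := fun _ w => Real.exp (-(c * ‖w‖ ^ 2)))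
      (fun _ => hg1)
    refine this.congr (Filter.Eventually.of_forall fun w => ?_)
    simp only [normSqC, ← Real.exp_sum, Finset.mul_sum, Finset.sum_neg_distrib]
  refine (hg.const_mul (((2 * i).factorial : ℝ) / c ^ (2 * i))).mono'
    (hcont.pow 2).aestronglyMeasurable (Filter.Eventually.of_forall fun w => ?_)
  have h0 : 0 ≤ normSqC w := Finset.sum_nonneg fun j _ => by positivity
  have h1 := Real.pow_div_factorial_le_exp (c * normSqC w) (by positivity) (2 * i)
  rw [div_le_iff₀ (by positivity)] at h1
  rw [Real.norm_of_nonneg (by positivity)]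
  have h2 : (normSqC w) ^ (2 * i) ≤
      ((2 * i).factorial : ℝ) / c ^ (2 * i) * Real.exp (c * normSqC w) := by
    rw [div_mul_eq_mul_div, le_div_iff₀ (by positivity)]
    calc _ = (c * normSqC w) ^ (2 * i) := by ring
      _ ≤ _ := h1
      _ = _ := by ring
  calc (normSqC w ^ i * Real.exp (-(c * normSqC w))) ^ 2
      = normSqC w ^ (2 * i) * (Real.exp (-(c * normSqC w)) * Real.exp (-(c * normSqC w))) := by
        ring
    _ ≤ (((2 * i).factorial : ℝ) / c ^ (2 * i) * Real.exp (c * normSqC w)) *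
        (Real.exp (-(c * normSqC w)) * Real.exp (-(c * normSqC w))) := by gcongr
    _ = ((2 * i).factorial : ℝ) / c ^ (2 * i) * Real.exp (-(c * normSqC w)) *
        (Real.exp (c * normSqC w) * Real.exp (-(c * normSqC w))) := by ring
    _ = _ := by rw [← Real.exp_add]; simp

theorem memLp_laguerreFun (n k : ℕ) {lam : ℝ} (h : lam ≠ 0) :
    MemLp (fun w : Fin n → ℂ => (laguerreFun n k lam w : ℂ)) 2 volume := by
  refine MemLp.ofReal (f := laguerreFun n k lam) ?_
  have hc : 0 < (1 / 4) * |lam| := by positivity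
  have := memLp_finsetSum (Finset.range (k + 1)) (f := fun i (w : Fin n → ℂ) =>
    ((-1 : ℝ) ^ i * ((k + (n - 1)).choose (k - i) : ℝ) * ((1 / 2) * |lam|) ^ i /
      (i.factorial : ℝ)) * (normSqC w ^ i * Real.exp (-((1 / 4) * |lam| * normSqC w))))
    (fun i _ => (memLp_gaussian_mul_pow n i hc).const_mul _)
  refine this.ae_eq (Filter.Eventually.of_forall fun w => ?_)
  simp only [laguerreFun, laguerreL, Finset.sum_mul]
  refine Finset.sum_congr rfl fun i _ => ?_
  ring

theorem integrable_twisted {n k : ℕ} {lam : ℝ} (h : lam ≠ 0) {g : (Fin n → ℂ) → ℂ}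
    (hg : MemLp g 2 volume) (z : Fin n → ℂ) :
    Integrable fun w : Fin n → ℂ => (laguerreFun n k lam (z - w) : ℂ) * g w *
      Complex.exp (Complex.I / 2 * lam * imDot z w) := by
  have h1 := (memLp_laguerreFun n k h).comp_measurePreserving
    (Measure.measurePreserving_sub_left (volume : Measure (Fin n → ℂ)) z)
  have h2 := h1.integrable_mul hg
  have hcont : Continuous fun w : Fin n → ℂ =>
      Complex.exp (Complex.I / 2 * lam * imDot z w) := by
    unfold imDot
    fun_prop
  refine h2.mono (h2.1.mul hcont.aestronglyMeasurable) (Filter.Eventually.of_forall fun w => ?_)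
  have : ‖Complex.exp (Complex.I / 2 * lam * imDot z w)‖ = 1 := by
    rw [Complex.norm_exp]
    simp
  simp [this]

theorem fanRepro_add {n : ℕ} {a : heisFan n} (h : a.1.1 ≠ 0) {g₁ g₂ : (Fin n → ℂ) → ℂ}
    (h₁ : MemLp g₁ 2 volume) (h₂ : MemLp g₂ 2 volume) (z : Fin n → ℂ) :
    fanRepro a (g₁ + g₂) z = fanRepro a g₁ z + fanRepro a g₂ z := by
  simp only [fanRepro, twistedConv]
  rw [← mul_add, ← integral_add (integrable_twisted h h₁ z) (integrable_twisted h h₂ z)]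
  congr 1
  refine integral_congr_ae (Filter.Eventually.of_forall fun w => ?_)
  simp only [Pi.add_apply]
  ring

theorem fanRepro_smul {n : ℕ} (a : heisFan n) (c : ℂ) (g : (Fin n → ℂ) → ℂ) (z : Fin n → ℂ) :
    fanRepro a (c • g) z = c * fanRepro a g z := by
  simp only [fanRepro, twistedConv]
  rw [mul_left_comm, ← integral_const_mul c]
  congr 1
  refine integral_congr_ae (Filter.Eventually.of_forall fun w => ?_)
  simp only [Pi.smul_apply, smul_eq_mul]
  ring

theorem fanRepro_congr {n : ℕ} (a : heisFan n) {g₁ g₂ : (Fin n → ℂ) → ℂ}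
    (h : g₁ =ᵐ[volume] g₂) (z : Fin n → ℂ) : fanRepro a g₁ z = fanRepro a g₂ z := by
  simp only [fanRepro, twistedConv]
  congr 1
  refine integral_congr_ae (μ := volume) ?_
  filter_upwards [h] with w hw
  simp only [hw]

theorem memLp_slice {n : ℕ} (F : L2Fan n) :
    ∀ᵐ a ∂(fanMeasure n), MemLp (fun z => F (a, z)) 2 (volume : Measure (Fin n → ℂ)) := by
  have hF := Lp.memLp F
  have h1 := ((memLp_two_iff_integrable_sq_norm hF.1).1 hF).prod_right_ae
  filter_upwards [h1, hF.1.prodMk_left] with a h2 h3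
  exact (memLp_two_iff_integrable_sq_norm h3).2 h2

/-- `L²₀(Ω × ℂⁿ, dν dw)`: the subspace of those `F ∈ L²(Ω × ℂⁿ, dν dw)` with
`(2π)^(-n) |λ|^n φ_{k,λ}^{n-1} *_λ F(a,·) = F(a,·)` (almost everywhere on `ℂⁿ`) for `ν`-almost
every `a = (λ,(2k+n)|λ|)`. -/
noncomputable def L2FanZero (n : ℕ) : Submodule ℂ (L2Fan n) where
  carrier := {F | ∀ᵐ a ∂(fanMeasure n),
    fanRepro a (fun w => F (a, w)) =ᵐ[volume] fun z => F (a, z)}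
  zero_mem' := by
    filter_upwards [Measure.ae_ae_of_ae_prod
      (Lp.coeFn_zero ℂ 2 ((fanMeasure n).prod (volume : Measure (Fin n → ℂ))))] with a ha
    filter_upwards [ha] with z hz
    rw [fanRepro_congr a ha z, hz]
    simp [fanRepro, twistedConv]
  add_mem' := by
    intro F G hF hG
    filter_upwards [hF, hG, memLp_slice F, memLp_slice G, ae_fan_ne_zero n,
      Measure.ae_ae_of_ae_prod (Lp.coeFn_add F G)] with a h1 h2 h3 h4 h5 h6
    filter_upwards [h1, h2, h6] with z h7 h8 h9
    rw [fanRepro_congr a h6 z, h9]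
    exact (fanRepro_add h5 h3 h4 z).trans (by rw [h7, h8]; rfl)
  smul_mem' := by
    intro c F hF
    filter_upwards [hF, Measure.ae_ae_of_ae_prod (Lp.coeFn_smul c F)] with a h1 h2
    filter_upwards [h1, h2] with z h3 h4
    rw [fanRepro_congr a h2 z, h4]
    exact (fanRepro_smul a c _ z).trans (by rw [h3]; rfl)

/-! For `λ ≠ 0` put `f^λ(w) = ∫ f(w,s) exp(-iλs) ds`. Carrying out the `s`-integral in the
definition gives `f̂(a,·) = φ_{k,λ} *_λ f^λ` for `a = (λ,(2k+n)|λ|)`. The limiting ray is `ν`-null,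
so the Bessel part plays no role. The transform is thus a Fourier transform in the central variable
followed, for each `λ`, by a twisted Laguerre expansion.

The first factor is `√(2π)` times a unitary operator (`norm_fiberFTL`, `fiberFTL_surjective`). For
the second, the operators `P_k = (2π)^(-n)|λ|^n φ_{k,λ} *_λ` are mutually orthogonal self-adjoint
projections on `L²(ℂⁿ)` with sum the identity. Hence `∑_k ‖φ_{k,λ} *_λ g‖² = (2π/|λ|)^(2n) ‖g‖²`,
and the density `(2π)^(-2n-1)|λ|^(2n)` of `ν` leaves the factor `(2π)^(-1)`, which cancels the `2π`
of the first step.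

Everything about the `P_k` comes from the generating function `M_r = ∑ r^k φ_{k,λ}`, a Gaussian. A
Gaussian integral gives `M_r *_λ M_s = (2π/|λ|)^n M_{rs}`, and comparing coefficients of `r^k s^j`
gives the projection relations (`twistedConv_laguerreFun`). If every `P_k h` vanishes, then `M_r *_λ
h = 0` for small `r`. Since `M_{s²}` is a multiple of `M_s *_λ M_s` and `M_s` acts self-adjointly,
the vanishing passes from `s²` to `s`, hence to parameters tending to `1`, where the Gaussians
concentrate and force `h = 0` (`ae_eq_zero_of_twistedConv_laguerreFun`).

For the range, let `F ∈ L²₀`. Its restriction to the ray `R_k` is the Laguerre transform of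
`(|λ|/2π)^n F` on that ray, because the other projections annihilate it. Anything orthogonal to the
range is therefore orthogonal to every such restriction, hence to `F`. The range of a scaled
isometry is closed, so `F` belongs to it. Thus `L²₀` equals the range, which also shows that it is
closed. -/

/-! ### Twisted convolution on `L²(ℂⁿ)`: boundedness, associativity, symmetry. -/

/-- The unimodular phase factor of the `λ`-twisted convolution. -/
noncomputable def twistPhase {n : ℕ} (lam : ℝ) (z w : Fin n → ℂ) : ℂ :=
  Complex.exp (Complex.I / 2 * lam * imDot z w)

theorem norm_twistPhase {n : ℕ} (lam : ℝ) (z w : Fin n → ℂ) : ‖twistPhase lam z w‖ = 1 := by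
  rw [twistPhase, Complex.norm_exp]
  simp

theorem continuous_twistPhase {n : ℕ} (lam : ℝ) :
    Continuous fun p : (Fin n → ℂ) × (Fin n → ℂ) => twistPhase lam p.1 p.2 := by
  unfold twistPhase imDot
  fun_prop

theorem continuous_twistPhase_right {n : ℕ} (lam : ℝ) (z : Fin n → ℂ) :
    Continuous (twistPhase lam z) := by
  unfold twistPhase imDot
  fun_prop

theorem imDot_swap {n : ℕ} (z w : Fin n → ℂ) : imDot w z = -imDot z w := by
  simp only [imDot, Complex.im_sum, ← Finset.sum_neg_distrib]
  refine Finset.sum_congr rfl fun j _ => ?_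
  simp
  ring

theorem imDot_sub_left {n : ℕ} (z w v : Fin n → ℂ) :
    imDot (z - w) v = imDot z v - imDot w v := by
  simp only [imDot, Complex.im_sum, ← Finset.sum_sub_distrib]
  refine Finset.sum_congr rfl fun j _ => ?_
  simp
  ring

theorem imDot_sub_right {n : ℕ} (z w v : Fin n → ℂ) :
    imDot z (w - v) = imDot z w - imDot z v := by
  rw [imDot_swap (w - v), imDot_sub_left, imDot_swap z w, imDot_swap z v]
  ring

theorem imDot_self {n : ℕ} (z : Fin n → ℂ) : imDot z z = 0 := by
  have := imDot_swap z z
  linarith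

theorem normSqC_nonneg {n : ℕ} (z : Fin n → ℂ) : 0 ≤ normSqC z :=
  Finset.sum_nonneg fun j _ => by positivity

theorem normSqC_neg {n : ℕ} (z : Fin n → ℂ) : normSqC (-z) = normSqC z := by
  simp [normSqC]

theorem continuous_normSqC {n : ℕ} : Continuous (normSqC : (Fin n → ℂ) → ℝ) := by
  unfold normSqC
  fun_prop

theorem star_twistPhase {n : ℕ} (lam : ℝ) (z w : Fin n → ℂ) :
    (starRingEnd ℂ) (twistPhase lam z w) = twistPhase lam w z := by
  rw [twistPhase, twistPhase, ← Complex.exp_conj, imDot_swap z w]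
  congr 1
  simp [Complex.conj_ofNat]
  ring

/-- The cocycle identity of the phase, in the translated form that the substitution `w ↦ w - v`
needs in the proof of associativity. -/
theorem twistPhase_mul {n : ℕ} (lam : ℝ) (z w v : Fin n → ℂ) :
    twistPhase lam z w * twistPhase lam w v =
      twistPhase lam (z - v) (w - v) * twistPhase lam z v := by
  simp only [twistPhase, ← Complex.exp_add]
  congr 1
  rw [imDot_sub_left, imDot_sub_right, imDot_sub_right, imDot_self, imDot_swap w v]
  push_cast
  ring

/-- Kernels for which twisted convolution acts boundedly on `L²(ℂⁿ)`. -/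
structure IsTwistKernel {n : ℕ} (f : (Fin n → ℂ) → ℂ) : Prop where
  continuous : Continuous f
  integrable : Integrable f volume
  memLp : MemLp f 2 volume

theorem twistedConv_eq {n : ℕ} (lam : ℝ) (f g : (Fin n → ℂ) → ℂ) (z : Fin n → ℂ) :
    twistedConv lam f g z = ∫ w, f (z - w) * g w * twistPhase lam z w := rfl

theorem MeasureTheory.MemLp.comp_sub_left_two {n : ℕ} {f : (Fin n → ℂ) → ℂ}
    (hf : MemLp f 2 volume) (z : Fin n → ℂ) : MemLp (fun w => f (z - w)) 2 volume :=
  hf.comp_measurePreserving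
    (Measure.measurePreserving_sub_left (volume : Measure (Fin n → ℂ)) z)

theorem integrable_twisted_of_memLp {n : ℕ} {f g : (Fin n → ℂ) → ℂ} (lam : ℝ)
    (hf : MemLp f 2 volume) (hg : MemLp g 2 volume) (z : Fin n → ℂ) :
    Integrable fun w => f (z - w) * g w * twistPhase lam z w := by
  have h2 := (hf.comp_sub_left_two z).integrable_mul hg
  have hc := continuous_twistPhase_right lam z
  refine h2.mono (h2.1.mul hc.aestronglyMeasurable) (.of_forall fun w => ?_)
  simp [norm_twistPhase]

theorem IsTwistKernel.integrable_mul_sq {n : ℕ} {f h : (Fin n → ℂ) → ℂ}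
    (hf : IsTwistKernel f) (hh : MemLp h 2 volume) :
    Integrable (fun p : (Fin n → ℂ) × (Fin n → ℂ) => ‖f (p.1 - p.2)‖ * ‖h p.2‖ ^ 2)
      (volume.prod volume) := by
  have := ((memLp_two_iff_integrable_sq_norm hh.1).1 hh).convolution_integrand
    (ContinuousLinearMap.mul ℝ ℝ) hf.integrable.norm
  refine this.congr (.of_forall fun p => ?_)
  simp [mul_comm]

theorem IsTwistKernel.neg_arg {n : ℕ} {f : (Fin n → ℂ) → ℂ} (hf : IsTwistKernel f) :
    IsTwistKernel fun z => f (-z) :=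
  ⟨hf.continuous.comp continuous_neg, hf.integrable.comp_neg,
    hf.memLp.comp_measurePreserving (Measure.measurePreserving_neg volume)⟩

/-- Domination by `|f(z-w)| (|h(w)|² + |u(z)|²)`, where each summand is an `L¹` convolution
integrand. This licenses the uses of Fubini in the associativity and symmetry arguments. -/
theorem IsTwistKernel.integrable_pair {n : ℕ} {f h u : (Fin n → ℂ) → ℂ}
    (hf : IsTwistKernel f) (hh : MemLp h 2 volume) (hu : MemLp u 2 volume) :
    Integrable (fun p : (Fin n → ℂ) × (Fin n → ℂ) => f (p.1 - p.2) * h p.2 * u p.1)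
      (volume.prod volume) := by
  have h1 := hf.integrable_mul_sq hh
  have h2 := (hf.neg_arg.integrable_mul_sq hu).swap
  refine (h1.add h2).mono' ?_ (.of_forall fun p => ?_)
  · exact ((hf.continuous.comp (continuous_fst.sub continuous_snd)).aestronglyMeasurable.mul
      hh.1.comp_snd).mul hu.1.comp_fst
  · simp only [norm_mul, Pi.add_apply, Function.comp, Prod.swap, neg_sub]
    have := sq_nonneg (‖h p.2‖ - ‖u p.1‖)
    have h3 := norm_nonneg (f (p.1 - p.2))
    have h4 : ‖h p.2‖ * ‖u p.1‖ ≤ ‖h p.2‖ ^ 2 + ‖u p.1‖ ^ 2 := by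
      nlinarith [sq_nonneg ‖h p.2‖, sq_nonneg ‖u p.1‖]
    calc ‖f (p.1 - p.2)‖ * ‖h p.2‖ * ‖u p.1‖ = ‖f (p.1 - p.2)‖ * (‖h p.2‖ * ‖u p.1‖) := by ring
      _ ≤ ‖f (p.1 - p.2)‖ * (‖h p.2‖ ^ 2 + ‖u p.1‖ ^ 2) := by gcongr
      _ = _ := by ring

theorem IsTwistKernel.integrable_pair_phase {n : ℕ} {f h u : (Fin n → ℂ) → ℂ} (lam : ℝ)
    (hf : IsTwistKernel f) (hh : MemLp h 2 volume) (hu : MemLp u 2 volume) :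
    Integrable (fun p : (Fin n → ℂ) × (Fin n → ℂ) =>
      f (p.1 - p.2) * h p.2 * twistPhase lam p.1 p.2 * u p.1) (volume.prod volume) := by
  have h1 := hf.integrable_pair hh hu
  have hc := (continuous_twistPhase (n := n) lam)
  refine h1.mono ?_ (.of_forall fun w => ?_)
  · exact (((hf.continuous.comp (continuous_fst.sub continuous_snd)).aestronglyMeasurable.mul
      hh.1.comp_snd).mul hc.aestronglyMeasurable).mul hu.1.comp_fst
  · simp [norm_twistPhase]

/-- Cauchy–Schwarz for the measure with density `F`. -/
theorem sq_integral_mul_le {α : Type*} [MeasurableSpace α] {μ : Measure α} {F H : α → ℝ}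
    (hF0 : 0 ≤ F) (hF : Integrable F μ) (hFH : Integrable (fun x => F x * H x) μ)
    (hFH2 : Integrable (fun x => F x * H x ^ 2) μ) :
    (∫ x, F x * H x ∂μ) ^ 2 ≤ (∫ x, F x ∂μ) * ∫ x, F x * H x ^ 2 ∂μ := by
  -- The quadratic polynomial is `∫ F (t - H)²`, so its discriminant is nonpositive.
  have key : ∀ t : ℝ, 0 ≤ (∫ x, F x ∂μ) * (t * t) + (-2 * ∫ x, F x * H x ∂μ) * t +
      ∫ x, F x * H x ^ 2 ∂μ := by
    intro t
    have : (∫ x, F x ∂μ) * (t * t) + (-2 * ∫ x, F x * H x ∂μ) * t + ∫ x, F x * H x ^ 2 ∂μ =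
        ∫ x, (F x * (t * t) + (-2 * (F x * H x)) * t + F x * H x ^ 2) ∂μ := by
      rw [integral_add _ hFH2, integral_add (hF.mul_const _), integral_mul_const,
        integral_mul_const, integral_const_mul]
      · exact (hFH.const_mul _).mul_const _
      · exact (hF.mul_const _).add ((hFH.const_mul _).mul_const _)
    rw [this]
    refine integral_nonneg fun x => ?_
    have : F x * (t * t) + (-2 * (F x * H x)) * t + F x * H x ^ 2 = F x * (t - H x) ^ 2 := by ring
    simp only [Pi.zero_apply]
    rw [this]
    exact mul_nonneg (hF0 x) (sq_nonneg _)
  have := discrim_le_zero key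
  rw [discrim] at this
  linarith

/-- Cauchy–Schwarz with weight `|f(z-·)|` gives `|f *_λ h|² ≤ ‖f‖₁ (|f| * |h|²)`, and the right side
is integrable. The phase disappears in absolute value. -/
theorem IsTwistKernel.memLp_twistedConv {n : ℕ} {f h : (Fin n → ℂ) → ℂ} (lam : ℝ)
    (hf : IsTwistKernel f) (hh : MemLp h 2 volume) : MemLp (twistedConv lam f h) 2 volume := by
  have hc := (continuous_twistPhase (n := n) lam)
  have hm : AEStronglyMeasurable (twistedConv lam f h) volume :=
    AEStronglyMeasurable.integral_prod_right' (μ := volume)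
      (f := fun p : (Fin n → ℂ) × (Fin n → ℂ) => f (p.1 - p.2) * h p.2 * twistPhase lam p.1 p.2)
      (((hf.continuous.comp (continuous_fst.sub continuous_snd)).aestronglyMeasurable.mul
        hh.1.comp_snd).mul hc.aestronglyMeasurable)
  rw [memLp_two_iff_integrable_sq_norm hm]
  have h1 := hf.integrable_mul_sq hh
  refine ((h1.integral_prod_left).const_mul (∫ w, ‖f w‖)).mono' (hm.norm.pow 2) ?_
  filter_upwards [h1.prod_right_ae] with z hz
  have hi := hf.integrable.norm.comp_sub_left z
  have hfh : Integrable (fun w => ‖f (z - w)‖ * ‖h w‖) := by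
    have := (integrable_twisted_of_memLp lam hf.memLp hh z).norm
    simpa only [norm_mul, norm_twistPhase, mul_one] using this
  have h2 := sq_integral_mul_le (μ := volume) (F := fun w => ‖f (z - w)‖) (H := fun w => ‖h w‖)
    (fun w => norm_nonneg _) hi hfh hz
  rw [integral_sub_left_eq_self (fun w => ‖f w‖) volume z] at h2
  rw [Real.norm_of_nonneg (by positivity)]
  refine le_trans ?_ h2
  gcongr
  refine (norm_integral_le_integral_norm _).trans_eq ?_
  simp only [norm_mul, Complex.norm_exp]
  refine integral_congr_ae (.of_forall fun w => ?_)
  simp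

theorem IsTwistKernel.twistedConv_assoc {n : ℕ} {f g h : (Fin n → ℂ) → ℂ} (lam : ℝ)
    (hf : MemLp f 2 volume) (hg : IsTwistKernel g) (hh : MemLp h 2 volume) (z : Fin n → ℂ) :
    twistedConv lam f (twistedConv lam g h) z = twistedConv lam (twistedConv lam f g) h z := by
  have hc := continuous_twistPhase_right lam z
  have hfz : MemLp (fun w => f (z - w) * twistPhase lam z w) 2 volume := by
    refine (hf.comp_sub_left_two z).mono
      ((hf.comp_sub_left_two z).1.mul hc.aestronglyMeasurable) (.of_forall fun w => ?_)
    simp [norm_twistPhase]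
  have hI := hg.integrable_pair_phase lam hh hfz
  calc twistedConv lam f (twistedConv lam g h) z
      = ∫ w, ∫ v, g (w - v) * h v * twistPhase lam w v * (f (z - w) * twistPhase lam z w) := by
        rw [twistedConv_eq]
        refine integral_congr_ae (.of_forall fun w => ?_)
        simp only
        rw [integral_mul_const, twistedConv_eq]
        ring
    _ = ∫ v, ∫ w, g (w - v) * h v * twistPhase lam w v * (f (z - w) * twistPhase lam z w) :=
        integral_integral_swap hI
    _ = _ := by
        rw [twistedConv_eq]
        refine integral_congr_ae (.of_forall fun v => ?_)
        simp only
        rw [twistedConv_eq, ← integral_mul_const, ← integral_mul_const,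
          ← integral_sub_right_eq_self (fun w => f (z - v - w) * g w *
            twistPhase lam (z - v) w * h v * twistPhase lam z v) v]
        refine integral_congr_ae (.of_forall fun w => ?_)
        simp only
        rw [sub_sub_sub_cancel_right]
        linear_combination (f (z - w) * g (w - v) * h v) * twistPhase_mul lam z w v

theorem IsTwistKernel.integral_star_mul_twistedConv {n : ℕ} {f h u : (Fin n → ℂ) → ℂ} (lam : ℝ)
    (hf : IsTwistKernel f) (hsymm : ∀ z, (starRingEnd ℂ) (f (-z)) = f z)
    (hh : MemLp h 2 volume) (hu : MemLp u 2 volume) :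
    ∫ z, twistedConv lam f h z * (starRingEnd ℂ) (u z) =
      ∫ z, h z * (starRingEnd ℂ) (twistedConv lam f u z) := by
  have hI := hf.integrable_pair_phase lam hh (u := fun z => (starRingEnd ℂ) (u z)) hu.star
  calc ∫ z, twistedConv lam f h z * (starRingEnd ℂ) (u z)
      = ∫ z, ∫ w, f (z - w) * h w * twistPhase lam z w * (starRingEnd ℂ) (u z) := by
        refine integral_congr_ae (.of_forall fun z => ?_)
        simp only
        rw [integral_mul_const, twistedConv_eq]
    _ = ∫ w, ∫ z, f (z - w) * h w * twistPhase lam z w * (starRingEnd ℂ) (u z) :=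
        integral_integral_swap hI
    _ = _ := by
        refine integral_congr_ae (.of_forall fun w => ?_)
        simp only
        rw [twistedConv_eq, ← integral_conj, ← integral_const_mul]
        refine integral_congr_ae (.of_forall fun z => ?_)
        simp only [map_mul, star_twistPhase]
        rw [← hsymm (z - w), neg_sub]
        ring

/-! ### Laguerre functions and their generating function. -/

/-- Summing absolute values over the second index by the negative binomial series leaves an
exponential series in `|x||r|/(1-|r|)`. -/
theorem summable_laguerre_double (m : ℕ) (x : ℝ) {r : ℝ} (hr : |r| < 1) :
    Summable fun p : ℕ × ℕ => ((-x) ^ p.1 / (p.1.factorial : ℝ) * r ^ p.1) *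
      (((p.2 + (p.1 + m)).choose (p.1 + m) : ℝ) * r ^ p.2) := by
  refine Summable.of_norm ?_
  have hin : ∀ i : ℕ, HasSum (fun l : ℕ => ‖((-x) ^ i / (i.factorial : ℝ) * r ^ i) *
      (((l + (i + m)).choose (i + m) : ℝ) * r ^ l)‖)
      ((|x| ^ i / (i.factorial : ℝ) * |r| ^ i) * (1 / (1 - |r|) ^ (i + m + 1))) := by
    intro i
    have := (hasSum_choose_mul_geometric_of_norm_lt_one (i + m) (r := |r|)
      (by simpa using hr)).mul_left (|x| ^ i / (i.factorial : ℝ) * |r| ^ i)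
    refine this.congr_fun fun l => ?_
    simp
  rw [summable_prod_of_nonneg fun _ => norm_nonneg _]
  refine ⟨fun i => (hin i).summable, ?_⟩
  simp_rw [fun i => (hin i).tsum_eq]
  refine ((Real.summable_pow_div_factorial (|x| * |r| / (1 - |r|))).mul_left
    (1 / (1 - |r|) ^ (m + 1))).congr fun i => ?_
  have : 1 - |r| ≠ 0 := by linarith
  rw [div_pow, mul_pow]
  field_simp
  ring

/-- The generating function of the Laguerre polynomials. -/
theorem hasSum_laguerreL (m : ℕ) (x : ℝ) {r : ℝ} (hr : |r| < 1) :
    HasSum (fun k => r ^ k * laguerreL m k x)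
      (((1 - r) ^ (m + 1))⁻¹ * Real.exp (-(x * r / (1 - r)))) := by
  have hr1 : 1 - r ≠ 0 := by
    have := (abs_lt.1 hr).2
    linarith
  have hs := summable_laguerre_double m x hr
  have hrow : ∀ i : ℕ, HasSum (fun l : ℕ => ((-x) ^ i / (i.factorial : ℝ) * r ^ i) *
      (((l + (i + m)).choose (i + m) : ℝ) * r ^ l))
      (((1 - r) ^ (m + 1))⁻¹ * ((-(x * r / (1 - r))) ^ i / (i.factorial : ℝ))) := by
    intro i
    have := (hasSum_choose_mul_geometric_of_norm_lt_one (i + m) (r := r)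
      (by simpa using hr)).mul_left ((-x) ^ i / (i.factorial : ℝ) * r ^ i)
    have e : ((1 - r) ^ (m + 1))⁻¹ * ((-(x * r / (1 - r))) ^ i / (i.factorial : ℝ)) =
        ((-x) ^ i / (i.factorial : ℝ) * r ^ i) * (1 / (1 - r) ^ (i + m + 1)) := by
      rw [neg_pow (x * r / (1 - r)), neg_pow x, div_pow, mul_pow]
      field_simp
      ring
    rw [e]
    exact this
  have hexp : HasSum (fun i : ℕ => ((1 - r) ^ (m + 1))⁻¹ *
      ((-(x * r / (1 - r))) ^ i / (i.factorial : ℝ)))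
      (((1 - r) ^ (m + 1))⁻¹ * Real.exp (-(x * r / (1 - r)))) := by
    have := NormedSpace.expSeries_div_hasSum_exp (𝔸 := ℝ) (-(x * r / (1 - r)))
    rw [← Real.exp_eq_exp_ℝ] at this
    exact this.mul_left _
  have htot := hs.hasSum
  rw [(htot.prod_fiberwise hrow).unique hexp] at htot
  -- Summed by rows the double series gives the closed form; regrouped along `i + l = k` it gives
  -- `r^k L_k^m(x)`.
  have hsig := (Finset.HasAntidiagonal.sigmaAntidiagonalEquivProd.hasSum_iff.2 htot).sigma
    fun k => hasSum_fintype _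
  refine hsig.congr_fun fun k => ?_
  simp only [Function.comp, Finset.HasAntidiagonal.sigmaAntidiagonalEquivProd_apply]
  rw [← Finset.attach_eq_univ,
    Finset.sum_attach (Finset.HasAntidiagonal.antidiagonal k) (fun p : ℕ × ℕ =>
    ((-x) ^ p.1 / (p.1.factorial : ℝ) * r ^ p.1) *
      (((p.2 + (p.1 + m)).choose (p.1 + m) : ℝ) * r ^ p.2)),
    Finset.Nat.sum_antidiagonal_eq_sum_range_succ_mk, laguerreL, Finset.mul_sum]
  refine Finset.sum_congr rfl fun i hi => ?_
  have hik : i ≤ k := Nat.lt_succ_iff.1 (Finset.mem_range.1 hi)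
  obtain ⟨l, rfl⟩ := Nat.exists_eq_add_of_le hik
  have hc : (l + (i + m)).choose (i + m) = (i + l + m).choose l := by
    rw [show i + l + m = l + (i + m) by ring, Nat.choose_symm_add]
  simp only [add_tsub_cancel_left]
  rw [hc, neg_pow x]
  ring

/-- The signs of the coefficients alternate, so at `-x` every term is nonnegative. -/
theorem abs_laguerreL_le (m k : ℕ) {x : ℝ} (hx : 0 ≤ x) :
    |laguerreL m k x| ≤ laguerreL m k (-x) := by
  refine (Finset.abs_sum_le_sum_abs _ _).trans_eq (Finset.sum_congr rfl fun i _ => ?_)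
  rw [abs_div, abs_mul, abs_mul, abs_pow, abs_pow, abs_neg, abs_one, one_pow, neg_pow x,
    abs_of_nonneg hx]
  simp only [Nat.abs_cast, one_mul]
  rw [show ∀ c d e : ℝ, d ^ i * c * (d ^ i * e) = (d * d) ^ i * (c * e) by intros; ring]
  norm_num

/-- A single term of the generating series at `-x`, `r = 1/4`, is at most its sum, all terms being
nonnegative. The exponent `x/3` is small enough for the Gaussian factor of `φ_{k,λ}` to dominate it,
and the growth `4^k` explains the later restriction `|r| < 1/4`. -/
theorem abs_laguerreL_le_exp (m k : ℕ) {x : ℝ} (hx : 0 ≤ x) :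
    |laguerreL m k x| ≤ 4 ^ k * ((4 / 3) ^ (m + 1) * Real.exp (x / 3)) := by
  have h := hasSum_laguerreL m (-x) (r := 1 / 4) (by norm_num [abs_of_pos])
  have h1 := le_hasSum h k fun j _ =>
    mul_nonneg (by positivity) ((abs_nonneg _).trans (abs_laguerreL_le m j hx))
  have h2 := abs_laguerreL_le m k hx
  have h3 : ((1 - 1 / 4 : ℝ) ^ (m + 1))⁻¹ * Real.exp (-(-x * (1 / 4) / (1 - 1 / 4))) =
      (4 / 3) ^ (m + 1) * Real.exp (x / 3) := by
    rw [← inv_pow]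
    congr 2
    · norm_num
    · ring
  rw [h3, one_div, inv_pow, inv_mul_le_iff₀ (by positivity)] at h1
  exact h2.trans h1

/-- The Gaussian `exp (-c |z|²)` on `ℂⁿ`. -/
noncomputable def gaussC (n : ℕ) (c : ℝ) (z : Fin n → ℂ) : ℂ := (Real.exp (-(c * normSqC z)) : ℂ)

theorem isTwistKernel_of_le_gauss {n : ℕ} {f : (Fin n → ℂ) → ℂ} (hf : Continuous f) {C c : ℝ}
    (hc : 0 < c) (hb : ∀ z, ‖f z‖ ≤ C * Real.exp (-(c * normSqC z))) : IsTwistKernel f := by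
  have h0 : ∀ d : ℝ, 0 < d → MemLp (fun w : Fin n → ℂ => Real.exp (-(d * normSqC w))) 2 := by
    intro d hd
    simpa using memLp_gaussian_mul_pow n 0 hd
  refine ⟨hf, ?_, ?_⟩
  · have h1 := (memLp_two_iff_integrable_sq (h0 (c / 2) (by positivity)).1).1
      (h0 (c / 2) (by positivity))
    refine (h1.const_mul C).mono' hf.aestronglyMeasurable (.of_forall fun z => ?_)
    refine (hb z).trans_eq ?_
    rw [pow_two, ← Real.exp_add]
    ring_nf
  · refine ((h0 c hc).const_mul C).mono hf.aestronglyMeasurable (.of_forall fun z => ?_)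
    exact (hb z).trans (le_abs_self _)

theorem continuous_gaussC (n : ℕ) (c : ℝ) : Continuous (gaussC n c) := by
  unfold gaussC normSqC
  fun_prop

theorem isTwistKernel_gaussC (n : ℕ) {c : ℝ} (hc : 0 < c) : IsTwistKernel (gaussC n c) :=
  isTwistKernel_of_le_gauss (continuous_gaussC n c) (C := 1) hc fun z => by
    rw [gaussC, Complex.norm_real, Real.norm_of_nonneg (Real.exp_pos _).le, one_mul]

theorem norm_laguerreFun_le {n : ℕ} (hn : 1 ≤ n) (k : ℕ) (lam : ℝ) (z : Fin n → ℂ) :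
    ‖(laguerreFun n k lam z : ℂ)‖ ≤
      4 ^ k * ((4 / 3) ^ n * Real.exp (-(|lam| / 12 * normSqC z))) := by
  have h0 := normSqC_nonneg z
  have h1 := abs_laguerreL_le_exp (n - 1) k (x := 1 / 2 * |lam| * normSqC z) (by positivity)
  rw [Nat.sub_add_cancel hn] at h1
  rw [Complex.norm_real, laguerreFun, norm_mul, Real.norm_eq_abs, Real.norm_eq_abs, Real.abs_exp]
  calc _ ≤ (4 ^ k * ((4 / 3) ^ n * Real.exp (1 / 2 * |lam| * normSqC z / 3))) *
        Real.exp (-(1 / 4 * |lam| * normSqC z)) := by gcongr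
    _ = 4 ^ k * ((4 / 3) ^ n * (Real.exp (1 / 2 * |lam| * normSqC z / 3) *
        Real.exp (-(1 / 4 * |lam| * normSqC z)))) := by ring
    _ = _ := by
      rw [← Real.exp_add]
      ring_nf

theorem isTwistKernel_laguerreFun {n : ℕ} (hn : 1 ≤ n) (k : ℕ) {lam : ℝ} (h : lam ≠ 0) :
    IsTwistKernel fun z : Fin n → ℂ => (laguerreFun n k lam z : ℂ) :=
  isTwistKernel_of_le_gauss (Complex.continuous_ofReal.comp (continuous_laguerreFun n k lam))
    (C := 4 ^ k * (4 / 3) ^ n) (c := |lam| / 12) (by positivity) fun z =>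
      (norm_laguerreFun_le hn k lam z).trans_eq (by ring)

/-- The generating function `∑ r^k φ_{k,λ}` of the Laguerre functions. -/
noncomputable def mehlerFun (n : ℕ) (lam r : ℝ) (z : Fin n → ℂ) : ℂ :=
  (((1 - r) ^ n)⁻¹ : ℝ) * gaussC n (|lam| / 4 * ((1 + r) / (1 - r))) z

theorem hasSum_laguerreFun {n : ℕ} (hn : 1 ≤ n) (lam : ℝ) {r : ℝ} (hr : |r| < 1)
    (z : Fin n → ℂ) :
    HasSum (fun k => (r : ℂ) ^ k * (laguerreFun n k lam z : ℂ)) (mehlerFun n lam r z) := by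
  have h := (hasSum_laguerreL (n - 1) (1 / 2 * |lam| * normSqC z) hr).mul_right
    (Real.exp (-(1 / 4 * |lam| * normSqC z)))
  have hr1 : 1 - r ≠ 0 := by
    have := (abs_lt.1 hr).2
    linarith
  rw [Nat.sub_add_cancel hn, mul_assoc ((1 - r) ^ n)⁻¹, ← Real.exp_add] at h
  have h2 := Complex.hasSum_ofReal.2 h
  have e : mehlerFun n lam r z = (((((1 - r) ^ n)⁻¹ *
      Real.exp (-(1 / 2 * |lam| * normSqC z * r / (1 - r)) +
        -(1 / 4 * |lam| * normSqC z))) : ℝ) : ℂ) := by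
    rw [mehlerFun, gaussC, ← Complex.ofReal_mul]
    congr 3
    field_simp
    ring
  rw [e]
  refine h2.congr_fun fun k => ?_
  simp only [laguerreFun]
  push_cast
  ring

/-! ### Twisted convolution of Gaussians and the semigroup law `M_r *_λ M_s = c M_{rs}`. -/

theorem integral_complex_gaussian {b : ℝ} (hb : 0 < b) (p q : ℂ) :
    ∫ w : ℂ, Complex.exp (-b * ((w.re : ℂ) ^ 2 + (w.im : ℂ) ^ 2) + (p * w.re + q * w.im)) =
      (Real.pi / b : ℂ) * Complex.exp ((p ^ 2 + q ^ 2) / (4 * b)) := by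
  have h := GaussianFourier.integral_cexp_neg_mul_sum_add (ι := Fin 2) (b := (b : ℂ))
    (by simpa using hb) ![p, q]
  have h2 := Complex.volume_preserving_equiv_pi.integral_comp
    Complex.measurableEquivPi.measurableEmbedding
    (fun v : Fin 2 → ℝ => Complex.exp (-b * ∑ i, (v i : ℂ) ^ 2 + ∑ i, ![p, q] i * v i))
  rw [h] at h2
  simpa [Fin.sum_univ_two, Complex.measurableEquivPi_apply] using h2

/-- The integral factors over coordinates. In each, the linear coefficients satisfy `p² + q² = (4A²
- λ²/4)|z_j|²`, the mixed terms cancelling; adding the prefactor `-A|z_j|²` gives the stated width.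
-/
theorem twistedConv_gaussC (n : ℕ) (lam : ℝ) {A B : ℝ} (hA : 0 < A) (hB : 0 < B)
    (z : Fin n → ℂ) :
    twistedConv lam (gaussC n A) (gaussC n B) z =
      ((Real.pi / (A + B)) ^ n : ℝ) *
        gaussC n ((4 * A * B + lam ^ 2 / 4) / (4 * (A + B))) z := by
  have hAB : 0 < A + B := by positivity
  have hABc : ((A : ℂ) + B) ≠ 0 := by exact_mod_cast hAB.ne'
  have h1 : ∀ w : Fin n → ℂ, gaussC n A (z - w) * gaussC n B w *
      Complex.exp (Complex.I / 2 * lam * imDot z w) =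
      ∏ j, Complex.exp (-A * ((z j).re ^ 2 + (z j).im ^ 2)) *
        Complex.exp (-((A + B : ℝ) : ℂ) * (((w j).re : ℂ) ^ 2 + ((w j).im : ℂ) ^ 2) +
        ((2 * A * (z j).re + Complex.I / 2 * lam * (z j).im) * (w j).re +
          (2 * A * (z j).im - Complex.I / 2 * lam * (z j).re) * (w j).im)) := by
    intro w
    simp only [← Complex.exp_add]
    rw [← Complex.exp_sum, gaussC, gaussC, Complex.ofReal_exp, Complex.ofReal_exp,
      ← Complex.exp_add, ← Complex.exp_add]
    congr 1
    simp only [normSqC, imDot, Complex.im_sum, Complex.ofReal_neg, Complex.ofReal_mul,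
      Complex.ofReal_sum, Finset.mul_sum, ← Finset.sum_neg_distrib, ← Finset.sum_add_distrib,
      Pi.sub_apply]
    refine Finset.sum_congr rfl fun j _ => ?_
    rw [Complex.sq_norm, Complex.sq_norm, Complex.normSq_apply, Complex.normSq_apply]
    simp
    ring
  have h2 : ∀ j : Fin n, (∫ w : ℂ, Complex.exp (-A * ((z j).re ^ 2 + (z j).im ^ 2)) *
        Complex.exp (-((A + B : ℝ) : ℂ) * ((w.re : ℂ) ^ 2 + (w.im : ℂ) ^ 2) +
        ((2 * A * (z j).re + Complex.I / 2 * lam * (z j).im) * w.re +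
          (2 * A * (z j).im - Complex.I / 2 * lam * (z j).re) * w.im))) =
      (Real.pi / (A + B) : ℂ) * Complex.exp
        (-(((4 * A * B + lam ^ 2 / 4) / (4 * (A + B)) * ‖z j‖ ^ 2 : ℝ))) := by
    intro j
    rw [integral_const_mul, integral_complex_gaussian hAB, mul_left_comm, ← Complex.exp_add]
    push_cast
    congr 2
    have : (‖z j‖ : ℂ) ^ 2 = (z j).re ^ 2 + (z j).im ^ 2 := by
      rw [← Complex.ofReal_pow, Complex.sq_norm, Complex.normSq_apply]
      push_cast
      ring
    rw [this]
    field_simp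
    ring_nf
    rw [Complex.I_sq]
    ring
  rw [twistedConv]
  simp_rw [h1]
  rw [integral_fintype_prod_volume_eq_prod (f := fun j (w : ℂ) =>
    Complex.exp (-A * ((z j).re ^ 2 + (z j).im ^ 2)) *
        Complex.exp (-((A + B : ℝ) : ℂ) * ((w.re : ℂ) ^ 2 + (w.im : ℂ) ^ 2) +
        ((2 * A * (z j).re + Complex.I / 2 * lam * (z j).im) * w.re +
          (2 * A * (z j).im - Complex.I / 2 * lam * (z j).re) * w.im)))]
  simp_rw [h2]
  rw [Finset.prod_mul_distrib, ← Complex.exp_sum, Finset.prod_const, Finset.card_univ,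
    Fintype.card_fin, gaussC, Complex.ofReal_exp, normSqC]
  push_cast
  rw [Finset.mul_sum, Finset.sum_neg_distrib]

/-- Reversing the factors costs a sign of `λ`. This allows a series in the right factor to be
treated as one in the left factor. -/
theorem twistedConv_swap {n : ℕ} (lam : ℝ) (f g : (Fin n → ℂ) → ℂ) (z : Fin n → ℂ) :
    twistedConv lam f g z = twistedConv (-lam) g f z := by
  rw [twistedConv, twistedConv, ← integral_sub_left_eq_self _ volume z]
  refine integral_congr_ae (.of_forall fun w => ?_)
  simp only [sub_sub_cancel, imDot_sub_right, imDot_self]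
  rw [mul_comm (f w)]
  congr 2
  push_cast
  ring

theorem twistedConv_mehlerFun {n : ℕ} {lam : ℝ} (h : lam ≠ 0) {r s : ℝ} (hr : |r| < 1)
    (hs : |s| < 1) (z : Fin n → ℂ) :
    twistedConv lam (mehlerFun n lam r) (mehlerFun n lam s) z =
      ((2 * Real.pi / |lam|) ^ n : ℝ) * mehlerFun n lam (r * s) z := by
  have ha : 0 < |lam| := abs_pos.2 h
  obtain ⟨hr1, hr2⟩ := abs_lt.1 hr
  obtain ⟨hs1, hs2⟩ := abs_lt.1 hs
  have hr3 : 0 < 1 - r := by linarith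
  have hs3 : 0 < 1 - s := by linarith
  have hr4 : 0 < 1 + r := by linarith
  have hs4 : 0 < 1 + s := by linarith
  have hrs : 0 < 1 - r * s := by nlinarith
  have hA : 0 < |lam| / 4 * ((1 + r) / (1 - r)) := by positivity
  have hB : 0 < |lam| / 4 * ((1 + s) / (1 - s)) := by positivity
  have e : |lam| / 4 * ((1 + r) / (1 - r)) + |lam| / 4 * ((1 + s) / (1 - s)) =
      |lam| / 2 * ((1 - r * s) / ((1 - r) * (1 - s))) := by
    field_simp
    ring
  have h1 := twistedConv_gaussC n lam hA hB z
  -- The width reproduces itself with `rs` in place of `r`, by the addition law of `(1+r)/(1-r)`, a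
  -- hyperbolic cotangent in `-½ log r` for `0 < r < 1`.
  have h2 : (4 * (|lam| / 4 * ((1 + r) / (1 - r))) * (|lam| / 4 * ((1 + s) / (1 - s))) +
      lam ^ 2 / 4) / (4 * (|lam| / 4 * ((1 + r) / (1 - r)) + |lam| / 4 * ((1 + s) / (1 - s)))) =
      |lam| / 4 * ((1 + r * s) / (1 - r * s)) := by
    rw [e, ← sq_abs lam]
    field_simp
    ring
  rw [h2, e] at h1
  have h3 : twistedConv lam (mehlerFun n lam r) (mehlerFun n lam s) z =
      (((1 - r) ^ n)⁻¹ * ((1 - s) ^ n)⁻¹ : ℝ) *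
        twistedConv lam (gaussC n (|lam| / 4 * ((1 + r) / (1 - r))))
          (gaussC n (|lam| / 4 * ((1 + s) / (1 - s)))) z := by
    rw [twistedConv, twistedConv, ← integral_const_mul]
    refine integral_congr_ae (.of_forall fun w => ?_)
    simp only [mehlerFun]
    push_cast
    ring
  rw [h3, h1, mehlerFun, ← mul_assoc, ← mul_assoc, ← Complex.ofReal_mul, ← Complex.ofReal_mul]
  congr 2
  rw [← mul_inv, ← mul_pow, ← inv_pow, ← mul_pow, ← inv_pow, ← mul_pow]
  congr 1
  field_simp

theorem isTwistKernel_mehlerFun {n : ℕ} {lam : ℝ} (h : lam ≠ 0) {r : ℝ} (hr : |r| < 1) :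
    IsTwistKernel (mehlerFun n lam r) := by
  have ha : 0 < |lam| := abs_pos.2 h
  obtain ⟨hr1, hr2⟩ := abs_lt.1 hr
  have hr3 : 0 < 1 - r := by linarith
  have hr4 : 0 < 1 + r := by linarith
  have hk := isTwistKernel_gaussC n
    (show 0 < |lam| / 4 * ((1 + r) / (1 - r)) by positivity)
  exact ⟨continuous_const.mul hk.continuous, hk.integrable.const_mul _, hk.memLp.const_mul _⟩

/-! ### Orthogonality of the Laguerre projections by comparison of coefficients. -/

/-- The twist `mu` is independent of the Laguerre parameter `lam` because the lemma is also applied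
with `mu = -lam`, after the factors have been exchanged. The bound `4^k` makes the geometric
majorant converge for `|r| < 1/4`. -/
theorem hasSum_twistedConv_laguerreFun {n : ℕ} (hn : 1 ≤ n) {lam : ℝ} (hl : lam ≠ 0) (mu : ℝ)
    {r : ℝ} (hr : |r| < 1 / 4) {h : (Fin n → ℂ) → ℂ} (hh : MemLp h 2 volume) (z : Fin n → ℂ) :
    HasSum (fun k => (r : ℂ) ^ k *
      twistedConv mu (fun w => (laguerreFun n k lam w : ℂ)) h z)
      (twistedConv mu (mehlerFun n lam r) h z) := by
  have hphase := continuous_twistPhase_right mu z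
  have hg : MemLp (fun w : Fin n → ℂ => Real.exp (-(|lam| / 12 * normSqC (z - w)))) 2 := by
    have h1 := memLp_gaussian_mul_pow n 0 (c := |lam| / 12) (by positivity)
    simp only [pow_zero, one_mul] at h1
    exact h1.comp_measurePreserving
      (Measure.measurePreserving_sub_left (volume : Measure (Fin n → ℂ)) z)
  have hgi : Integrable fun w : Fin n → ℂ =>
      (4 / 3) ^ n * (Real.exp (-(|lam| / 12 * normSqC (z - w))) * ‖h w‖) :=
    (hg.integrable_mul hh.norm).const_mul _
  have h4r : 4 * |r| < 1 := by linarith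
  have hgeo := hasSum_geometric_of_lt_one (r := 4 * |r|) (by positivity) h4r
  have key := hasSum_integral_of_dominated_convergence (μ := (volume : Measure (Fin n → ℂ)))
    (F := fun k w => (r : ℂ) ^ k * ((laguerreFun n k lam (z - w) : ℂ) * h w *
      Complex.exp (Complex.I / 2 * mu * imDot z w)))
    (f := fun w => mehlerFun n lam r (z - w) * h w *
      Complex.exp (Complex.I / 2 * mu * imDot z w))
    (fun k w => (4 * |r|) ^ k * ((4 / 3) ^ n *
      (Real.exp (-(|lam| / 12 * normSqC (z - w))) * ‖h w‖))) ?_ ?_ ?_ ?_ ?_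
  · refine key.congr_fun fun k => ?_
    rw [twistedConv, integral_const_mul]
  · intro k
    have h1 : AEStronglyMeasurable (fun w => (laguerreFun n k lam (z - w) : ℂ)) volume :=
      (Complex.continuous_ofReal.comp ((continuous_laguerreFun n k lam).comp
        (continuous_const.sub continuous_id))).aestronglyMeasurable
    exact ((h1.mul hh.1).mul hphase.aestronglyMeasurable).const_mul _
  · intro k
    refine .of_forall fun w => ?_
    have h1 := norm_laguerreFun_le hn k lam (z - w)
    have h2 := norm_twistPhase mu z w
    rw [twistPhase] at h2
    rw [norm_mul, norm_mul, norm_mul, h2, norm_pow, Complex.norm_real, Real.norm_eq_abs r]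
    calc |r| ^ k * (‖(laguerreFun n k lam (z - w) : ℂ)‖ * ‖h w‖ * 1)
        ≤ |r| ^ k * ((4 ^ k * ((4 / 3) ^ n *
          Real.exp (-(|lam| / 12 * normSqC (z - w))))) * ‖h w‖ * 1) := by gcongr
      _ = _ := by ring
  · exact .of_forall fun w => hgeo.summable.mul_right _
  · simp_rw [fun w => (hgeo.mul_right ((4 / 3) ^ n *
      (Real.exp (-(|lam| / 12 * normSqC (z - w))) * ‖h w‖))).tsum_eq]
    exact hgi.const_mul _
  · refine .of_forall fun w => ?_
    have h1 := (hasSum_laguerreFun hn lam (hr.trans (by norm_num)) (z - w)).mul_right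
      (h w * Complex.exp (Complex.I / 2 * mu * imDot z w))
    rw [← mul_assoc] at h1
    refine h1.congr_fun fun k => ?_
    ring

/-- A power series converging on a real neighbourhood of `0` is determined by its sum. -/
theorem powerSeries_coeff_unique {a b : ℕ → ℂ} {F : ℝ → ℂ} {ρ : ℝ} (hρ : 0 < ρ)
    (ha : ∀ r : ℝ, |r| < ρ → HasSum (fun k => (r : ℂ) ^ k * a k) (F r))
    (hb : ∀ r : ℝ, |r| < ρ → HasSum (fun k => (r : ℂ) ^ k * b k) (F r)) : a = b := by
  have key : ∀ c : ℕ → ℂ, (∀ r : ℝ, |r| < ρ → HasSum (fun k => (r : ℂ) ^ k * c k) (F r)) →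
      HasFPowerSeriesAt F ((fun k => ContinuousMultilinearMap.mkPiRing ℝ (Fin k) (c k) :
        FormalMultilinearSeries ℝ ℝ ℂ)) 0 := by
    intro c hc
    refine hasFPowerSeriesAt_iff.2 ?_
    filter_upwards [Metric.ball_mem_nhds (0 : ℝ) hρ] with r hr
    rw [mem_ball_zero_iff, Real.norm_eq_abs] at hr
    rw [zero_add]
    refine (hc r hr).congr_fun fun k => ?_
    simp [FormalMultilinearSeries.coeff, Complex.real_smul]
  have h := (key a ha).eq_formalMultilinearSeries (key b hb)
  funext k
  have h1 := congrArg (fun p : FormalMultilinearSeries ℝ ℝ ℂ => p.coeff k) h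
  simpa [FormalMultilinearSeries.coeff] using h1

/-- The Laguerre functions are, up to a scalar, orthogonal idempotents for the twisted
convolution. -/
theorem twistedConv_laguerreFun {n : ℕ} (hn : 1 ≤ n) {lam : ℝ} (hl : lam ≠ 0) (k j : ℕ)
    (z : Fin n → ℂ) :
    twistedConv lam (fun w => (laguerreFun n k lam w : ℂ))
      (fun w => (laguerreFun n j lam w : ℂ)) z =
      if j = k then ((2 * Real.pi / |lam|) ^ n : ℝ) * (laguerreFun n k lam z : ℂ) else 0 := by
  -- With `s` fixed, comparing coefficients of powers of `r` in the semigroup law gives `φ_i *_λ M_s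
  -- = (2π/|λ|)^n s^i φ_i`.
  have h1 : ∀ s : ℝ, |s| < 1 / 4 →
      (fun i => twistedConv lam (fun w => (laguerreFun n i lam w : ℂ)) (mehlerFun n lam s) z) =
      fun i => (s : ℂ) ^ i * (((2 * Real.pi / |lam|) ^ n : ℝ) * (laguerreFun n i lam z : ℂ)) := by
    intro s hs
    have hs1 : |s| < 1 := hs.trans (by norm_num)
    refine powerSeries_coeff_unique (ρ := 1 / 4) (by norm_num)
      (F := fun r => ((2 * Real.pi / |lam|) ^ n : ℝ) * mehlerFun n lam (r * s) z)
      (fun r hr => ?_) (fun r hr => ?_)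
    · have hr1 : |r| < 1 := hr.trans (by norm_num)
      have := hasSum_twistedConv_laguerreFun hn hl lam hr (isTwistKernel_mehlerFun hl hs1).memLp z
      rwa [twistedConv_mehlerFun hl hr1 hs1] at this
    · have hrs : |r * s| < 1 := by
        rw [abs_mul]
        nlinarith [abs_nonneg r, abs_nonneg s]
      refine ((hasSum_laguerreFun hn lam hrs z).mul_left
        (((2 * Real.pi / |lam|) ^ n : ℝ) : ℂ)).congr_fun fun i => ?_
      push_cast
      ring
  -- Now the right factor is expanded in powers of `s`; only the coefficient of `s^k` survives.
  have h2 := powerSeries_coeff_unique (ρ := 1 / 4) (by norm_num)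
      (a := fun i => twistedConv lam (fun w => (laguerreFun n k lam w : ℂ))
        (fun w => (laguerreFun n i lam w : ℂ)) z)
      (b := fun i => if i = k then ((2 * Real.pi / |lam|) ^ n : ℝ) * (laguerreFun n k lam z : ℂ)
        else 0)
      (F := fun s => twistedConv lam (fun w => (laguerreFun n k lam w : ℂ)) (mehlerFun n lam s) z)
      (fun s hs => ?_) (fun s hs => ?_)
  · exact congrFun h2 j
  · have := hasSum_twistedConv_laguerreFun hn hl (-lam) hs
      (isTwistKernel_laguerreFun hn k hl).memLp z
    rw [← twistedConv_swap] at this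
    refine this.congr_fun fun i => ?_
    rw [twistedConv_swap]
  · have e := congrFun (h1 s hs) k
    rw [e]
    refine (hasSum_ite_eq k ((s : ℂ) ^ k *
      (((2 * Real.pi / |lam|) ^ n : ℝ) * (laguerreFun n k lam z : ℂ)))).congr_fun fun i => ?_
    split_ifs with h
    · rw [h]
    · simp

/-! ### Gaussian approximate identity and completeness of the Laguerre expansion. -/

@[fun_prop]
theorem Continuous.twistPhase {n : ℕ} {α : Type*} [TopologicalSpace α] (lam : ℝ)
    {f g : α → Fin n → ℂ} (hf : Continuous f) (hg : Continuous g) :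
    Continuous fun x => twistPhase lam (f x) (g x) := by
  unfold _root_.twistPhase imDot
  fun_prop

@[fun_prop]
theorem Continuous.gaussC {n : ℕ} {α : Type*} [TopologicalSpace α] (c : ℝ)
    {f : α → Fin n → ℂ} (hf : Continuous f) : Continuous fun x => gaussC n c (f x) := by
  unfold _root_.gaussC normSqC
  fun_prop

theorem twistedConv_congr {n : ℕ} (lam : ℝ) (f : (Fin n → ℂ) → ℂ) {g₁ g₂ : (Fin n → ℂ) → ℂ}
    (h : g₁ =ᵐ[volume] g₂) (z : Fin n → ℂ) : twistedConv lam f g₁ z = twistedConv lam f g₂ z := by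
  refine integral_congr_ae ?_
  filter_upwards [h] with w hw
  rw [hw]

theorem twistedConv_const_mul_left {n : ℕ} (lam : ℝ) (c : ℂ) (f g : (Fin n → ℂ) → ℂ)
    (z : Fin n → ℂ) : twistedConv lam (fun w => c * f w) g z = c * twistedConv lam f g z := by
  rw [twistedConv, twistedConv, ← integral_const_mul]
  refine integral_congr_ae (.of_forall fun w => ?_)
  simp only
  ring

theorem twistedConv_const_mul_right {n : ℕ} (lam : ℝ) (c : ℂ) (f g : (Fin n → ℂ) → ℂ)
    (z : Fin n → ℂ) : twistedConv lam f (fun w => c * g w) z = c * twistedConv lam f g z := by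
  rw [twistedConv, twistedConv, ← integral_const_mul]
  refine integral_congr_ae (.of_forall fun w => ?_)
  simp only
  ring

theorem IsTwistKernel.twistedConv_add {n : ℕ} (lam : ℝ) {f g₁ g₂ : (Fin n → ℂ) → ℂ}
    (hf : IsTwistKernel f) (h₁ : MemLp g₁ 2 volume) (h₂ : MemLp g₂ 2 volume) (z : Fin n → ℂ) :
    twistedConv lam f (g₁ + g₂) z = twistedConv lam f g₁ z + twistedConv lam f g₂ z := by
  simp only [twistedConv_eq]
  rw [← integral_add (integrable_twisted_of_memLp lam hf.memLp h₁ z)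
    (integrable_twisted_of_memLp lam hf.memLp h₂ z)]
  refine integral_congr_ae (.of_forall fun w => ?_)
  simp only [Pi.add_apply]
  ring

theorem normSqC_le_add {n : ℕ} (y v : Fin n → ℂ) :
    normSqC y ≤ 2 * normSqC (y + v) + 2 * normSqC v := by
  simp only [normSqC, Finset.mul_sum, ← Finset.sum_add_distrib]
  refine Finset.sum_le_sum fun j _ => ?_
  have h1 : ‖y j‖ ≤ ‖(y + v) j‖ + ‖v j‖ := by
    have := norm_sub_le ((y + v) j) (v j)
    simpa using this
  nlinarith [sq_nonneg (‖(y + v) j‖ - ‖v j‖), norm_nonneg (y j)]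

theorem normSqC_smul {n : ℕ} (c : ℝ) (z : Fin n → ℂ) : normSqC (c • z) = c ^ 2 * normSqC z := by
  simp only [normSqC, Finset.mul_sum]
  refine Finset.sum_congr rfl fun j _ => ?_
  rw [Pi.smul_apply, norm_smul, mul_pow, Real.norm_eq_abs, sq_abs]

/-- The Gaussian convolution formula with `λ = 0` and `A = B = 1/2`, evaluated at the origin. -/
theorem integral_gaussC_one (n : ℕ) : ∫ v, gaussC n 1 v = (Real.pi : ℂ) ^ n := by
  have h := twistedConv_gaussC n 0 (A := 1 / 2) (B := 1 / 2) (by norm_num) (by norm_num) 0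
  rw [twistedConv] at h
  have e : ∀ w : Fin n → ℂ, gaussC n (1 / 2) (0 - w) * gaussC n (1 / 2) w *
      Complex.exp (Complex.I / 2 * (0 : ℝ) * imDot 0 w) = gaussC n 1 w := by
    intro w
    rw [zero_sub, gaussC, gaussC, normSqC_neg, ← Complex.ofReal_mul, ← Real.exp_add]
    simp only [Complex.ofReal_zero, mul_zero, zero_mul, Complex.exp_zero, mul_one, gaussC]
    ring_nf
  simp_rw [e] at h
  rw [h]
  simp [gaussC, normSqC]
  norm_num

theorem exists_le_gauss_of_hasCompactSupport {n : ℕ} {u : (Fin n → ℂ) → ℝ} (hu : Continuous u)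
    (hc : HasCompactSupport u) :
    ∃ C, ∀ z, ‖u z‖ ≤ C * Real.exp (-(1 / 4 * normSqC z)) := by
  have h1 : Continuous fun z => u z * Real.exp (1 / 4 * normSqC z) :=
    hu.mul (Real.continuous_exp.comp (continuous_const.mul continuous_normSqC))
  obtain ⟨C, hC⟩ := (hc.mul_right
    (f' := fun z => Real.exp (1 / 4 * normSqC z))).exists_bound_of_continuous h1
  refine ⟨C, fun z => ?_⟩
  have h2 := hC z
  simp only [Pi.mul_apply, norm_mul, Real.norm_eq_abs (Real.exp _), Real.abs_exp] at h2
  rw [Real.exp_neg, ← div_eq_mul_inv, le_div_iff₀ (Real.exp_pos _)]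
  exact h2

/-- The twisted convolutions with Gaussians form an approximate identity; in particular they
determine the function. -/
theorem ae_eq_zero_of_twistedConv_gaussC {n : ℕ} (lam : ℝ) {h : (Fin n → ℂ) → ℂ}
    (hh : MemLp h 2 volume) {b : ℕ → ℝ} (hb : ∀ m, 0 < b m)
    (hlim : Filter.Tendsto b Filter.atTop Filter.atTop)
    (hz : ∀ m, twistedConv lam (gaussC n (b m)) h =ᵐ[volume] 0) : h =ᵐ[volume] 0 := by
  refine ae_eq_zero_of_integral_contDiff_smul_eq_zero (hh.locallyIntegrable (by norm_num))
    fun u hu1 hu2 => ?_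
  have hu := hu1.continuous
  obtain ⟨C, hC⟩ := exists_le_gauss_of_hasCompactSupport hu hu2
  have hC0 : 0 ≤ C := by
    have := (norm_nonneg _).trans (hC 0)
    simpa [normSqC] using this
  have huL : MemLp (fun z => (u z : ℂ)) 2 volume :=
    (isTwistKernel_of_le_gauss (Complex.continuous_ofReal.comp hu) (C := C) (c := 1 / 4)
      (by norm_num) fun z => by simpa using hC z).memLp
  -- After the substitution `z = y + εv`, with `ε = b^(-1/2)`, the pairing of the twisted
  -- convolution with the test function `u` becomes, up to the Jacobian, the integral of `K ε` over
  -- `(y,v)`.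
  let K : ℝ → (Fin n → ℂ) × (Fin n → ℂ) → ℂ := fun ε p =>
    gaussC n 1 p.2 * u (p.1 + ε • p.2) * twistPhase lam (p.1 + ε • p.2) p.1 * h p.1
  -- From `|y|² ≤ 2|y+εv|² + 2|v|²` for `0 ≤ ε ≤ 1`: the decay `exp(-|y+εv|²/4)` of `u` is at most
  -- `exp(-|y|²/8 + |v|²/4)`, and the Gaussian in `v` absorbs the loss, leaving `3/4`.
  let bd : (Fin n → ℂ) × (Fin n → ℂ) → ℝ := fun p =>
    (C * (Real.exp (-(1 / 8 * normSqC p.1)) * ‖h p.1‖)) * Real.exp (-(3 / 4 * normSqC p.2))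
  have hKm : ∀ ε, AEStronglyMeasurable (K ε) (volume.prod volume) := by
    intro ε
    have h1 : Continuous fun p : (Fin n → ℂ) × (Fin n → ℂ) =>
        gaussC n 1 p.2 * u (p.1 + ε • p.2) * twistPhase lam (p.1 + ε • p.2) p.1 := by
      fun_prop
    have h6 : AEStronglyMeasurable (fun p : (Fin n → ℂ) × (Fin n → ℂ) => h p.1)
        (volume.prod volume) := hh.1.comp_fst
    exact h1.aestronglyMeasurable.mul h6
  have hbd : Integrable bd (volume.prod volume) := by
    have h1 : MemLp (fun w : Fin n → ℂ => Real.exp (-(1 / 8 * normSqC w))) 2 := by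
      simpa using memLp_gaussian_mul_pow n 0 (c := 1 / 8) (by norm_num)
    have h2 : Integrable (fun w : Fin n → ℂ => Real.exp (-(3 / 4 * normSqC w))) := by
      refine (isTwistKernel_gaussC n (c := 3 / 4) (by norm_num)).integrable.norm.congr
        (.of_forall fun w => ?_)
      simp only [gaussC, Complex.norm_real, Real.norm_of_nonneg (Real.exp_pos _).le]
    exact ((h1.integrable_mul hh.norm).const_mul C).mul_prod h2
  have hKb : ∀ ε, 0 ≤ ε → ε ≤ 1 → ∀ p, ‖K ε p‖ ≤ bd p := by
    intro ε h0 h1 p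
    have h2 := hC (p.1 + ε • p.2)
    have h3 := normSqC_le_add p.1 (ε • p.2)
    rw [normSqC_smul] at h3
    have h4 : ε ^ 2 * normSqC p.2 ≤ normSqC p.2 :=
      mul_le_of_le_one_left (normSqC_nonneg _) (pow_le_one₀ h0 h1)
    simp only [K, bd, norm_mul, norm_twistPhase, gaussC, Complex.norm_real, mul_one,
      Real.norm_of_nonneg (Real.exp_pos _).le]
    calc Real.exp (-(1 * normSqC p.2)) * ‖u (p.1 + ε • p.2)‖ * ‖h p.1‖
        ≤ Real.exp (-(1 * normSqC p.2)) *
          (C * Real.exp (-(1 / 4 * normSqC (p.1 + ε • p.2)))) * ‖h p.1‖ := by gcongr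
      _ = C * ‖h p.1‖ * Real.exp (-(1 * normSqC p.2) +
          -(1 / 4 * normSqC (p.1 + ε • p.2))) := by rw [Real.exp_add]; ring
      _ ≤ C * ‖h p.1‖ * Real.exp (-(1 / 8 * normSqC p.1) + -(3 / 4 * normSqC p.2)) := by
          refine mul_le_mul_of_nonneg_left (Real.exp_le_exp.2 ?_) (by positivity)
          linarith
      _ = _ := by rw [Real.exp_add]; ring
  have hKi : ∀ ε, 0 ≤ ε → ε ≤ 1 → Integrable (K ε) (volume.prod volume) := fun ε h0 h1 =>
    hbd.mono' (hKm ε) (.of_forall (hKb ε h0 h1))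
  let ε : ℕ → ℝ := fun m => 1 / √(b m)
  have hε0 : ∀ m, 0 < ε m := fun m => one_div_pos.2 (Real.sqrt_pos.2 (hb m))
  have hεlim : Filter.Tendsto ε Filter.atTop (nhds 0) := by
    simp only [ε, one_div]
    exact (Real.tendsto_sqrt_atTop.comp hlim).inv_tendsto_atTop
  have hzero : ∀ m, ε m ≤ 1 → ∫ p, K (ε m) p ∂(volume.prod volume) = 0 := by
    intro m hm
    rw [integral_prod _ (hKi _ (hε0 m).le hm)]
    have hk := isTwistKernel_gaussC n (hb m)
    have h1 : ∀ y, ∫ v, K (ε m) (y, v) = |((ε m) ^ Module.finrank ℝ (Fin n → ℂ))⁻¹| •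
        ∫ z, gaussC n (b m) (z - y) * h y * twistPhase lam z y * u z := by
      intro y
      have h2 := Measure.integral_comp_smul (volume : Measure (Fin n → ℂ))
        (fun v => gaussC n (b m) v * h y * twistPhase lam (y + v) y * u (y + v)) (ε m)
      have h3 := integral_add_left_eq_self (μ := (volume : Measure (Fin n → ℂ)))
        (fun z => gaussC n (b m) (z - y) * h y * twistPhase lam z y * u z) y
      simp only [add_sub_cancel_left] at h3
      rw [← h3, ← h2]
      refine integral_congr_ae (.of_forall fun v => ?_)
      simp only [K, gaussC, normSqC_smul, ε, div_pow, one_pow, Real.sq_sqrt (hb m).le]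
      rw [← mul_assoc, mul_one_div_cancel (hb m).ne']
      ring
    simp_rw [h1]
    rw [integral_smul, ← integral_integral_swap (hk.integrable_pair_phase lam hh huL)]
    have h4 : ∀ᵐ z, (∫ w, gaussC n (b m) (z - w) * h w * twistPhase lam z w * u z) = 0 := by
      filter_upwards [hz m] with z h5
      rw [integral_mul_const, ← twistedConv_eq, h5]
      simp
    rw [integral_congr_ae h4]
    simp
  have hK0 : ∀ᵐ p ∂(volume.prod volume), Filter.Tendsto (fun m => K (ε m) p) Filter.atTop
      (nhds (K 0 p)) := by
    refine .of_forall fun p => ?_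
    have h1 : Continuous fun t : ℝ => K t p := by
      simp only [K]
      fun_prop
    exact (h1.tendsto 0).comp hεlim
  have hev : ∀ᶠ m in Filter.atTop, ε m ≤ 1 := hεlim.eventually_le_const one_pos
  have hDCT := tendsto_integral_filter_of_dominated_convergence bd
    (.of_forall fun m => hKm (ε m))
    (hev.mono fun m hm => .of_forall (hKb (ε m) (hε0 m).le hm)) hbd hK0
  have hK00 : ∫ p, K 0 p ∂(volume.prod volume) = 0 :=
    tendsto_nhds_unique hDCT (tendsto_const_nhds.congr'
      (hev.mono fun m hm => (hzero m hm).symm))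
  -- At `ε = 0` the phase is trivial because `Im(y · ȳ) = 0`, so the integral splits.
  have hfin : ∫ p, K 0 p ∂(volume.prod volume) = (∫ z, u z • h z) * ∫ v, gaussC n 1 v := by
    rw [← integral_prod_mul]
    refine integral_congr_ae (.of_forall fun p => ?_)
    simp only [K, zero_smul, add_zero, twistPhase, imDot_self]
    simp
    ring
  rw [hfin, integral_gaussC_one] at hK00
  exact (mul_eq_zero.1 hK00).resolve_right (pow_ne_zero _ (by exact_mod_cast Real.pi_ne_zero))

theorem star_laguerreFun_neg (n k : ℕ) (lam : ℝ) (z : Fin n → ℂ) :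
    (starRingEnd ℂ) (laguerreFun n k lam (-z) : ℂ) = (laguerreFun n k lam z : ℂ) := by
  rw [Complex.conj_ofReal, laguerreFun, laguerreFun, normSqC_neg]

theorem star_mehlerFun_neg (n : ℕ) (lam r : ℝ) (z : Fin n → ℂ) :
    (starRingEnd ℂ) (mehlerFun n lam r (-z)) = mehlerFun n lam r z := by
  rw [mehlerFun, gaussC, mehlerFun, gaussC, normSqC_neg, map_mul, Complex.conj_ofReal,
    Complex.conj_ofReal]

/-- By symmetry and the semigroup law, `‖M_s *_λ h‖²` equals `∫ h · conj(M_s *_λ M_s *_λ h)`, a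
multiple of the pairing of `h` with `M_{s²} *_λ h = 0`. -/
theorem mehlerFun_twistedConv_eq_zero_of_sq {n : ℕ} {lam : ℝ} (hl : lam ≠ 0) {s : ℝ}
    (hs : |s| < 1) {h : (Fin n → ℂ) → ℂ} (hh : MemLp h 2 volume)
    (h0 : twistedConv lam (mehlerFun n lam (s * s)) h =ᵐ[volume] 0) :
    twistedConv lam (mehlerFun n lam s) h =ᵐ[volume] 0 := by
  have hk := isTwistKernel_mehlerFun (n := n) hl hs
  have hL := hk.memLp_twistedConv lam hh
  have h1 := hk.integral_star_mul_twistedConv lam (star_mehlerFun_neg n lam s) hh hL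
  have h2 : ∀ z, twistedConv lam (mehlerFun n lam s) (twistedConv lam (mehlerFun n lam s) h) z =
      ((2 * Real.pi / |lam|) ^ n : ℝ) * twistedConv lam (mehlerFun n lam (s * s)) h z := by
    intro z
    rw [IsTwistKernel.twistedConv_assoc lam hk.memLp hk hh z, ← twistedConv_const_mul_left]
    congr 1
    funext w
    exact twistedConv_mehlerFun hl hs hs w
  have h3 : ∫ z, h z * (starRingEnd ℂ) (twistedConv lam (mehlerFun n lam s)
      (twistedConv lam (mehlerFun n lam s) h) z) = 0 := by
    refine integral_eq_zero_of_ae ?_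
    filter_upwards [h0] with z hz
    rw [h2, hz]
    simp
  rw [h3] at h1
  have h4 : ∫ z, ‖twistedConv lam (mehlerFun n lam s) h z‖ ^ 2 = 0 := by
    have h5 : ∀ z : ℂ, z * (starRingEnd ℂ) z = ((‖z‖ ^ 2 : ℝ) : ℂ) := fun z => by
      rw [Complex.mul_conj, Complex.normSq_eq_norm_sq]
    simp_rw [h5] at h1
    rw [integral_complex_ofReal] at h1
    exact_mod_cast h1
  rw [integral_eq_zero_iff_of_nonneg (fun z => sq_nonneg _)
    ((memLp_two_iff_integrable_sq_norm hL.1).1 hL)] at h4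
  filter_upwards [h4] with z hz
  simpa using hz

/-- Completeness of the twisted Laguerre expansion. -/
theorem ae_eq_zero_of_twistedConv_laguerreFun {n : ℕ} (hn : 1 ≤ n) {lam : ℝ} (hl : lam ≠ 0)
    {h : (Fin n → ℂ) → ℂ} (hh : MemLp h 2 volume)
    (h0 : ∀ k, twistedConv lam (fun w => (laguerreFun n k lam w : ℂ)) h =ᵐ[volume] 0) :
    h =ᵐ[volume] 0 := by
  have ha : 0 < |lam| := abs_pos.2 hl
  -- Iterated square roots of `1/5`: the first lies within the range `|r| < 1/4` of the series
  -- expansion, each is the square of the next, and they tend to `1`.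
  let r : ℕ → ℝ := fun m => (1 / 5 : ℝ) ^ ((1 / 2 : ℝ) ^ m)
  have hr0 : ∀ m, 0 < r m := fun m => Real.rpow_pos_of_pos (by norm_num) _
  have hr1 : ∀ m, r m < 1 := fun m =>
    Real.rpow_lt_one (by norm_num) (by norm_num) (by positivity)
  have hrabs : ∀ m, |r m| < 1 := fun m => by rw [abs_of_pos (hr0 m)]; exact hr1 m
  have hrr : ∀ m, r (m + 1) * r (m + 1) = r m := by
    intro m
    simp only [r]
    rw [← Real.rpow_add (by norm_num)]
    congr 1
    ring
  have hrlim : Filter.Tendsto r Filter.atTop (nhds 1) := by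
    have h1 : Filter.Tendsto (fun m : ℕ => (1 / 2 : ℝ) ^ m) Filter.atTop (nhds 0) :=
      tendsto_pow_atTop_nhds_zero_of_lt_one (by norm_num) (by norm_num)
    have h2 := ((Real.continuous_const_rpow (a := 1 / 5) (by norm_num)).tendsto 0).comp h1
    rwa [Real.rpow_zero] at h2
  have hz : ∀ m, twistedConv lam (mehlerFun n lam (r m)) h =ᵐ[volume] 0 := by
    intro m
    induction m with
    | zero =>
      filter_upwards [ae_all_iff.2 h0] with z hz
      have h1 := hasSum_twistedConv_laguerreFun hn hl lam (r := r 0)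
        (by simp only [r, pow_zero, Real.rpow_one]; norm_num [abs_of_pos]) hh z
      simp_rw [hz, Pi.zero_apply, mul_zero] at h1
      exact h1.unique hasSum_zero
    | succ m ih =>
      refine mehlerFun_twistedConv_eq_zero_of_sq hl (hrabs _) hh ?_
      rwa [hrr]
  have hpos : ∀ m, 0 < 1 - r m := fun m => sub_pos.2 (hr1 m)
  refine ae_eq_zero_of_twistedConv_gaussC lam hh
    (b := fun m => |lam| / 4 * ((1 + r m) / (1 - r m))) (fun m => ?_) ?_ fun m => ?_
  · have := hpos m
    have := hr0 m
    positivity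
  · refine Filter.Tendsto.const_mul_atTop (by positivity) ?_
    simp_rw [div_eq_mul_inv]
    refine Filter.Tendsto.pos_mul_atTop (C := 2) (by norm_num) ?_
      (Filter.Tendsto.inv_tendsto_nhdsGT_zero (tendsto_nhdsWithin_iff.2
        ⟨?_, .of_forall fun m => hpos m⟩))
    · have := hrlim.const_add 1
      norm_num at this
      exact this
    · have := hrlim.const_sub 1
      simpa using this
  · filter_upwards [hz m] with z h1
    have h2 := twistedConv_const_mul_left lam ((((1 - r m) ^ n)⁻¹ : ℝ) : ℂ)
      (gaussC n (|lam| / 4 * ((1 + r m) / (1 - r m)))) h z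
    have h3 : (fun w => ((((1 - r m) ^ n)⁻¹ : ℝ) : ℂ) *
      gaussC n (|lam| / 4 * ((1 + r m) / (1 - r m))) w) = mehlerFun n lam (r m) := rfl
    rw [h3, h1] at h2
    refine (mul_eq_zero.1 h2.symm).resolve_left ?_
    have := (pow_pos (hpos m) n).ne'
    exact_mod_cast inv_ne_zero this

/-! ### Plancherel identity for the twisted Laguerre expansion. -/

/-- Parseval's identity for a complete sequence of mutually orthogonal symmetric projections. -/
theorem hasSum_norm_sq_of_projections {H : Type*} [NormedAddCommGroup H] [InnerProductSpace ℂ H]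
    [CompleteSpace H] {T : ℕ → H →ₗ[ℂ] H} (hsym : ∀ k, (T k).IsSymmetric)
    (horth : ∀ j k x, T j (T k x) = if j = k then T k x else 0)
    (hcomp : ∀ x, (∀ k, T k x = 0) → x = 0) (x : H) :
    HasSum (fun k => ‖T k x‖ ^ 2) (‖x‖ ^ 2) := by
  have hinner : ∀ k y, inner ℂ y (T k y) = ((‖T k y‖ ^ 2 : ℝ) : ℂ) := by
    intro k y
    have h1 := horth k k y
    rw [if_pos rfl] at h1
    have h2 := hsym k y (T k y)
    rw [h1, inner_self_eq_norm_sq_to_K] at h2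
    rw [← h2]
    norm_cast
  have hfam : OrthogonalFamily ℂ (fun k => LinearMap.range (T k))
      fun k => (LinearMap.range (T k)).subtypeₗᵢ := by
    intro j k hjk
    rintro ⟨_, y, rfl⟩ ⟨_, z, rfl⟩
    change inner ℂ (T j y) (T k z) = 0
    rw [hsym j, horth, if_neg hjk, inner_zero_right]
  have hbessel : ∀ s : Finset ℕ, ∑ k ∈ s, ‖T k x‖ ^ 2 ≤ ‖x‖ ^ 2 := by
    intro s
    have h1 := hfam.norm_sum (fun k => ⟨T k x, x, rfl⟩) s
    change ‖∑ k ∈ s, T k x‖ ^ 2 = ∑ k ∈ s, ‖T k x‖ ^ 2 at h1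
    have h2 : inner ℂ x (∑ k ∈ s, T k x) = ((∑ k ∈ s, ‖T k x‖ ^ 2 : ℝ) : ℂ) := by
      rw [inner_sum]
      simp_rw [hinner]
      norm_cast
    -- Bessel's inequality, from the nonnegativity of the squared distance between `x` and the
    -- partial sum.
    have h3 := norm_sub_sq (𝕜 := ℂ) x (∑ k ∈ s, T k x)
    rw [h2, h1] at h3
    change _ = ‖x‖ ^ 2 - 2 * (∑ k ∈ s, ‖T k x‖ ^ 2) + _ at h3
    nlinarith [sq_nonneg ‖x - ∑ k ∈ s, T k x‖]
  have hsum : Summable fun k => T k x :=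
    (hfam.summable_iff_norm_sq_summable fun k => ⟨T k x, x, rfl⟩).2
      (summable_of_sum_le (fun k => sq_nonneg _) hbessel)
  have hx : x = ∑' k, T k x := by
    refine sub_eq_zero.1 (hcomp _ fun j => ?_)
    -- An everywhere defined symmetric operator on a complete space is continuous
    -- (Hellinger–Toeplitz), so `T j` may be applied termwise. The remainder is then annihilated by
    -- all projections.
    have h1 := hsum.hasSum.mapL ⟨T j, (hsym j).continuous⟩
    simp only [ContinuousLinearMap.coe_mk', horth] at h1
    have h2 : HasSum (fun k => if j = k then T k x else 0) (T j x) := by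
      have := hasSum_ite_eq j (T j x)
      refine this.congr_fun fun k => ?_
      split_ifs with h1 h2 h2
      · rw [h1]
      · exact (h2 h1.symm).elim
      · exact (h1 h2.symm).elim
      · rfl
    rw [map_sub, sub_eq_zero]
    exact h2.unique h1
  have h1 := hsum.hasSum.mapL (innerSL ℂ x)
  rw [← hx] at h1
  simp only [innerSL_apply_apply, hinner, inner_self_eq_norm_sq_to_K] at h1
  rw [← Complex.hasSum_ofReal]
  rw [Complex.ofReal_pow]
  exact h1

/-- Twisted convolution by a kernel as an operator on `L²(ℂⁿ)`. -/
noncomputable def IsTwistKernel.op {n : ℕ} {f : (Fin n → ℂ) → ℂ} (hf : IsTwistKernel f)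
    (lam : ℝ) : Lp ℂ 2 (volume : Measure (Fin n → ℂ)) →ₗ[ℂ] Lp ℂ 2 (volume : Measure (Fin n → ℂ))
    where
  toFun h := (hf.memLp_twistedConv lam (Lp.memLp h)).toLp _
  map_add' h₁ h₂ := by
    rw [← MemLp.toLp_add, MemLp.toLp_eq_toLp_iff]
    refine .of_forall fun z => ?_
    rw [twistedConv_congr lam f (Lp.coeFn_add h₁ h₂) z,
      hf.twistedConv_add lam (Lp.memLp h₁) (Lp.memLp h₂) z]
    rfl
  map_smul' c h := by
    rw [RingHom.id_apply, ← MemLp.toLp_const_smul, MemLp.toLp_eq_toLp_iff]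
    refine .of_forall fun z => ?_
    rw [twistedConv_congr lam f (Lp.coeFn_smul c h) z]
    exact twistedConv_const_mul_right lam c f h z

theorem IsTwistKernel.coeFn_op {n : ℕ} {f : (Fin n → ℂ) → ℂ} (hf : IsTwistKernel f)
    (lam : ℝ) (h : Lp ℂ 2 (volume : Measure (Fin n → ℂ))) :
    hf.op lam h =ᵐ[volume] twistedConv lam f h :=
  MemLp.coeFn_toLp (hf.memLp_twistedConv lam (Lp.memLp h))

theorem IsTwistKernel.op_isSymmetric {n : ℕ} {f : (Fin n → ℂ) → ℂ} (hf : IsTwistKernel f)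
    (lam : ℝ) (hsymm : ∀ z, (starRingEnd ℂ) (f (-z)) = f z) : (hf.op lam).IsSymmetric := by
  intro x y
  have h1 := hf.integral_star_mul_twistedConv lam hsymm (Lp.memLp y) (Lp.memLp x)
  rw [L2.inner_def, L2.inner_def]
  simp only [RCLike.inner_apply]
  calc ∫ a, y a * (starRingEnd ℂ) (hf.op lam x a)
      = ∫ a, y a * (starRingEnd ℂ) (twistedConv lam f x a) := by
        refine integral_congr_ae ?_
        filter_upwards [hf.coeFn_op lam x] with a ha
        rw [ha]
    _ = _ := by
        rw [← h1]
        refine integral_congr_ae ?_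
        filter_upwards [hf.coeFn_op lam y] with a ha
        rw [ha]

theorem twistedConv_laguerreFun_twistedConv {n : ℕ} (hn : 1 ≤ n) {lam : ℝ} (hl : lam ≠ 0)
    {h : (Fin n → ℂ) → ℂ} (hh : MemLp h 2 volume) (j k : ℕ) (z : Fin n → ℂ) :
    twistedConv lam (fun w => (laguerreFun n j lam w : ℂ))
      (twistedConv lam (fun w => (laguerreFun n k lam w : ℂ)) h) z =
      if j = k then ((2 * Real.pi / |lam|) ^ n : ℝ) *
        twistedConv lam (fun w => (laguerreFun n k lam w : ℂ)) h z else 0 := by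
  rw [IsTwistKernel.twistedConv_assoc lam (isTwistKernel_laguerreFun hn j hl).memLp
    (isTwistKernel_laguerreFun hn k hl) hh z]
  have h1 := twistedConv_laguerreFun hn hl j k
  split_ifs with hjk
  · subst hjk
    rw [← twistedConv_const_mul_left]
    congr 1
    funext w
    rw [h1, if_pos rfl]
  · have h2 : twistedConv lam (fun w => (laguerreFun n j lam w : ℂ))
        (fun w => (laguerreFun n k lam w : ℂ)) = fun w => 0 * (0 : ℂ) := by
      funext w
      rw [h1, if_neg (Ne.symm hjk), zero_mul]
    rw [h2, twistedConv_const_mul_left, zero_mul]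

theorem norm_sq_eq_integral {α : Type*} [MeasurableSpace α] {μ : Measure α} (x : Lp ℂ 2 μ) :
    ‖x‖ ^ 2 = ∫ a, ‖x a‖ ^ 2 ∂μ := by
  have h := inner_self_eq_norm_sq_to_K (𝕜 := ℂ) x
  have h1 : ∀ a, inner ℂ (x a) (x a) = ((‖x a‖ ^ 2 : ℝ) : ℂ) := fun a => by
    rw [inner_self_eq_norm_sq_to_K (𝕜 := ℂ) (x a)]
    norm_cast
  rw [L2.inner_def] at h
  simp_rw [h1] at h
  rw [integral_complex_ofReal] at h
  have h2 := congrArg Complex.re h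
  rw [Complex.ofReal_re] at h2
  rw [h2, ← RCLike.ofReal_pow]
  rfl

/-- The Plancherel identity for the twisted Laguerre expansion. -/
theorem hasSum_norm_twistedConv_laguerreFun {n : ℕ} (hn : 1 ≤ n) {lam : ℝ} (hl : lam ≠ 0)
    {h : (Fin n → ℂ) → ℂ} (hh : MemLp h 2 volume) :
    HasSum (fun k => ∫ z, ‖twistedConv lam (fun w => (laguerreFun n k lam w : ℂ)) h z‖ ^ 2)
      (((2 * Real.pi / |lam|) ^ n) ^ 2 * ∫ z, ‖h z‖ ^ 2) := by
  set C : ℝ := (2 * Real.pi / |lam|) ^ n with hC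
  have ha : 0 < |lam| := abs_pos.2 hl
  have hC0 : 0 < C := by positivity
  have hCc : (C : ℂ) ≠ 0 := by exact_mod_cast hC0.ne'
  have hk := fun k => isTwistKernel_laguerreFun hn k hl
  -- The constant `C = (2π/|λ|)^n` is the one in the relation `φ_k *_λ φ_k = C φ_k`; division by it
  -- produces idempotents.
  let T : ℕ → Lp ℂ 2 (volume : Measure (Fin n → ℂ)) →ₗ[ℂ] Lp ℂ 2 (volume : Measure (Fin n → ℂ)) :=
    fun k => ((C⁻¹ : ℝ) : ℂ) • (hk k).op lam
  have hT : ∀ k x, T k x =ᵐ[volume] fun z =>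
      (C : ℂ)⁻¹ * twistedConv lam (fun w => (laguerreFun n k lam w : ℂ)) x z := by
    intro k x
    filter_upwards [Lp.coeFn_smul ((C⁻¹ : ℝ) : ℂ) ((hk k).op lam x), (hk k).coeFn_op lam x]
      with z h1 h2
    simp only [T, LinearMap.smul_apply]
    rw [h1, Pi.smul_apply, h2, smul_eq_mul, Complex.ofReal_inv]
  have hP := hasSum_norm_sq_of_projections (T := T) (fun k => ?_) (fun j k x => ?_)
    (fun x hx => ?_) (hh.toLp h)
  · have h1 : ∀ k, ‖T k (hh.toLp h)‖ ^ 2 = (C ^ 2)⁻¹ *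
        ∫ z, ‖twistedConv lam (fun w => (laguerreFun n k lam w : ℂ)) h z‖ ^ 2 := by
      intro k
      rw [norm_sq_eq_integral, ← integral_const_mul]
      refine integral_congr_ae ?_
      filter_upwards [hT k (hh.toLp h)] with z hz
      rw [hz, twistedConv_congr _ _ hh.coeFn_toLp, norm_mul, mul_pow, norm_inv, Complex.norm_real,
        Real.norm_of_nonneg hC0.le, inv_pow]
    have h2 : ‖hh.toLp h‖ ^ 2 = ∫ z, ‖h z‖ ^ 2 := by
      rw [norm_sq_eq_integral]
      refine integral_congr_ae ?_
      filter_upwards [hh.coeFn_toLp] with z hz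
      rw [hz]
    simp_rw [h1] at hP
    rw [h2] at hP
    refine (hP.mul_left (C ^ 2)).congr_fun fun k => ?_
    rw [mul_inv_cancel_left₀ (by positivity)]
  · exact fun x y => by
      simp only [T, LinearMap.smul_apply, inner_smul_left, inner_smul_right, Complex.conj_ofReal]
      rw [(hk k).op_isSymmetric lam (star_laguerreFun_neg n k lam)]
  · refine Lp.ext ?_
    have h1 : ∀ z, twistedConv lam (fun w => (laguerreFun n j lam w : ℂ)) (T k x) z =
        if j = k then twistedConv lam (fun w => (laguerreFun n k lam w : ℂ)) x z else 0 := by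
      intro z
      rw [twistedConv_congr _ _ (hT k x), twistedConv_const_mul_right,
        twistedConv_laguerreFun_twistedConv hn hl (Lp.memLp x), ← hC]
      split_ifs
      · rw [inv_mul_cancel_left₀ hCc]
      · rw [mul_zero]
    split_ifs with hjk
    · filter_upwards [hT j (T k x), hT k x] with z h2 h3
      rw [h2, h3, h1, if_pos hjk]
    · filter_upwards [hT j (T k x), Lp.coeFn_zero ℂ 2 (volume : Measure (Fin n → ℂ))] with z h2 h3
      rw [h2, h3, h1, if_neg hjk, mul_zero, Pi.zero_apply]
  · refine Lp.ext ((ae_eq_zero_of_twistedConv_laguerreFun hn hl (Lp.memLp x) fun k => ?_).trans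
      (Lp.coeFn_zero ℂ 2 (volume : Measure (Fin n → ℂ))).symm)
    have h1 := hT k x
    rw [hx k] at h1
    filter_upwards [h1, Lp.coeFn_zero ℂ 2 (volume : Measure (Fin n → ℂ))] with z h2 h3
    rw [h3, Pi.zero_apply] at h2
    exact (mul_eq_zero.1 h2.symm).resolve_left (inv_ne_zero hCc)

/-! ### The Fourier transform in the central variable on `L²`. -/

theorem eLpNorm_two_sq {α : Type*} [MeasurableSpace α] {μ : Measure α} (f : α → ℂ) :
    eLpNorm f 2 μ ^ 2 = ∫⁻ a, ‖f a‖ₑ ^ 2 ∂μ := by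
  have := eLpNorm_nnreal_pow_eq_lintegral (μ := μ) (f := f) (p := 2) (by norm_num)
  simpa using this

theorem memLp_two_iff_lintegral {α : Type*} [MeasurableSpace α] {μ : Measure α} {f : α → ℂ}
    (hf : AEStronglyMeasurable f μ) : MemLp f 2 μ ↔ ∫⁻ a, ‖f a‖ₑ ^ 2 ∂μ < ⊤ := by
  rw [← eLpNorm_two_sq, MemLp, and_iff_right hf, ENNReal.pow_lt_top_iff]
  simp

theorem enorm_sq_eq_lintegral {α : Type*} [MeasurableSpace α] {μ : Measure α} (x : Lp ℂ 2 μ) :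
    ‖x‖ₑ ^ 2 = ∫⁻ a, ‖x a‖ₑ ^ 2 ∂μ := by
  rw [Lp.enorm_def, eLpNorm_two_sq]

open FourierTransform in
/-- On `L¹ ∩ L²` the Fourier transform of `L²` is given by the Fourier integral. -/
theorem fourier_toLp_ae_eq {f : ℝ → ℂ} (hf₁ : Integrable f) (hf₂ : MemLp f 2 volume) :
    ((𝓕 (hf₂.toLp f) : Lp ℂ 2 (volume : Measure ℝ)) : ℝ → ℂ) =ᵐ[volume] 𝓕 f := by
  have hcont : Continuous (𝓕 f) := VectorFourier.fourierIntegral_continuous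
    Real.continuous_fourierChar (by exact continuous_inner) hf₁
  have hg := (Lp.memLp (𝓕 (hf₂.toLp f) : Lp ℂ 2 (volume : Measure ℝ)))
  have hgl := hg.locallyIntegrable (by norm_num)
  -- Paired with a test function `u`, both sides equal `∫ (𝓕 u) f`: one by the tempered-distribution
  -- description of the `L²` transform, the other by Fubini.
  have key : ∀ᵐ x, ((𝓕 (hf₂.toLp f) : Lp ℂ 2 (volume : Measure ℝ)) : ℝ → ℂ) x - 𝓕 f x = 0 := by
    refine ae_eq_zero_of_integral_contDiff_smul_eq_zero
      (hgl.sub hcont.locallyIntegrable) fun u hu1 hu2 => ?_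
    have h₁ : HasCompactSupport (Complex.ofRealCLM ∘ u) := hu2.comp_left rfl
    have h₂ : ContDiff ℝ ((⊤ : ℕ∞) : WithTop ℕ∞) (Complex.ofRealCLM ∘ u) := by fun_prop
    let S := h₁.toSchwartzMap h₂
    have hS : ∀ x, S x = (u x : ℂ) := fun x => rfl
    have e1 : ∫ x, u x • ((𝓕 (hf₂.toLp f) : Lp ℂ 2 (volume : Measure ℝ)) : ℝ → ℂ) x =
        ∫ x, (𝓕 S) x • f x := by
      have h3 := Lp.fourier_toTemperedDistribution_eq (hf₂.toLp f)
      have h4 := congrArg (fun T => T S) h3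
      simp only [TemperedDistribution.fourier_apply, Lp.toTemperedDistribution_apply] at h4
      have h5 : ∫ x, (𝓕 S) x • (hf₂.toLp f) x = ∫ x, (𝓕 S) x • f x := by
        refine integral_congr_ae ?_
        filter_upwards [hf₂.coeFn_toLp] with x hx
        rw [hx]
      rw [← h5, h4]
      refine integral_congr_ae (.of_forall fun x => ?_)
      simp only [hS, Complex.real_smul, smul_eq_mul]
    have e2 : ∫ x, (𝓕 S) x • f x = ∫ x, u x • 𝓕 f x := by
      have h3 := VectorFourier.integral_fourierIntegral_smul_eq_flip (L := innerₗ ℝ)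
        Real.continuous_fourierChar continuous_inner
        (S.integrable (μ := volume)) hf₁
      rw [SchwartzMap.fourier_coe]
      refine h3.trans ?_
      rw [flip_innerₗ]
      rfl
    simp_rw [smul_sub]
    rw [integral_sub, e1, e2, sub_self]
    · exact hgl.integrable_smul_left_of_hasCompactSupport hu1.continuous hu2
    · exact hcont.locallyIntegrable.integrable_smul_left_of_hasCompactSupport hu1.continuous hu2
  filter_upwards [key] with x hx
  exact sub_eq_zero.1 hx

/-- The Fourier integral `∫ g(s) exp(-iλs) ds`. -/
noncomputable def spectralFT (g : ℝ → ℂ) (lam : ℝ) : ℂ :=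
  ∫ s, g s * Complex.exp (-(Complex.I * lam * s))

open FourierTransform in
theorem spectralFT_eq (g : ℝ → ℂ) (lam : ℝ) : spectralFT g lam = 𝓕 g ((2 * Real.pi)⁻¹ * lam) := by
  rw [Real.fourier_real_eq_integral_exp_smul, spectralFT]
  refine integral_congr_ae (.of_forall fun s => ?_)
  simp only [smul_eq_mul]
  rw [mul_comm]
  congr 2
  have : (Real.pi : ℂ) ≠ 0 := by exact_mod_cast Real.pi_ne_zero
  push_cast
  field_simp

/-- Plancherel for the kernel `exp(-2πiξs)`; the substitution `λ = 2πξ` contributes the factor `2π`.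
-/
theorem lintegral_enorm_spectralFT {g : ℝ → ℂ} (h₁ : Integrable g) (h₂ : MemLp g 2 volume) :
    ∫⁻ lam, ‖spectralFT g lam‖ₑ ^ 2 = ENNReal.ofReal (2 * Real.pi) * ∫⁻ s, ‖g s‖ₑ ^ 2 := by
  open FourierTransform in
  have h3 : ∫⁻ x, ‖𝓕 g x‖ₑ ^ 2 = ∫⁻ s, ‖g s‖ₑ ^ 2 := by
    have e1 : ∫⁻ x, ‖𝓕 g x‖ₑ ^ 2 =
        ‖(𝓕 (h₂.toLp g) : Lp ℂ 2 (volume : Measure ℝ))‖ₑ ^ 2 := by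
      rw [enorm_sq_eq_lintegral]
      refine lintegral_congr_ae ?_
      filter_upwards [fourier_toLp_ae_eq h₁ h₂] with x hx
      rw [hx]
    have e2 : ‖h₂.toLp g‖ₑ ^ 2 = ∫⁻ s, ‖g s‖ₑ ^ 2 := by
      rw [enorm_sq_eq_lintegral]
      refine lintegral_congr_ae ?_
      filter_upwards [h₂.coeFn_toLp] with x hx
      rw [hx]
    rw [e1, ← e2, ← ofReal_norm, ← ofReal_norm, Lp.norm_fourier_eq]
  have hpi : (0 : ℝ) < 2 * Real.pi := by positivity
  have hne : (2 * Real.pi)⁻¹ ≠ 0 := by positivity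
  have hemb : MeasurableEmbedding fun x : ℝ => (2 * Real.pi)⁻¹ * x :=
    (Homeomorph.mulLeft₀ _ hne).measurableEmbedding
  simp_rw [spectralFT_eq]
  have h4 := hemb.lintegral_map (μ := volume) (fun x => ‖FourierTransform.fourier g x‖ₑ ^ 2)
  rw [← h4, Real.map_volume_mul_left hne, lintegral_smul_measure, h3, inv_inv,
    abs_of_pos hpi, smul_eq_mul]

/-- The Fourier integral in the last variable. -/
noncomputable def fiberFT {α : Type*} (f : α × ℝ → ℂ) (p : α × ℝ) : ℂ :=
  spectralFT (fun s => f (p.1, s)) p.2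

theorem fiberFT_smul {α : Type*} (c : ℂ) (f : α × ℝ → ℂ) (p : α × ℝ) :
    fiberFT (c • f) p = c * fiberFT f p := by
  simp only [fiberFT, spectralFT]
  rw [← integral_const_mul]
  refine integral_congr_ae (.of_forall fun s => ?_)
  simp only [Pi.smul_apply, smul_eq_mul]
  ring

section FiberFT

variable {α : Type*} [MeasurableSpace α] {μ : Measure α}

theorem aestronglyMeasurable_fiberFT [SFinite μ] {f : α × ℝ → ℂ}
    (hf : AEStronglyMeasurable f (μ.prod volume)) :
    AEStronglyMeasurable (fiberFT f) (μ.prod volume) := by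
  have hq : Measure.QuasiMeasurePreserving (Prod.map Prod.fst id : (α × ℝ) × ℝ → α × ℝ)
      ((μ.prod volume).prod volume) (μ.prod volume) :=
    QuasiMeasurePreserving.prodMap Measure.quasiMeasurePreserving_fst
      (Measure.QuasiMeasurePreserving.id volume)
  have hexp : AEStronglyMeasurable (fun q : (α × ℝ) × ℝ =>
      Complex.exp (-(Complex.I * q.1.2 * q.2))) ((μ.prod volume).prod volume) :=
    Measurable.aestronglyMeasurable (by fun_prop)
  have h := AEStronglyMeasurable.integral_prod_right'
    ((hf.comp_quasiMeasurePreserving hq).mul hexp)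
  exact h

theorem ae_fiber_integrable [SFinite μ] {f : α × ℝ → ℂ} (h₁ : Integrable f (μ.prod volume))
    (h₂ : MemLp f 2 (μ.prod volume)) :
    ∀ᵐ w ∂μ, Integrable (fun s => f (w, s)) ∧ MemLp (fun s => f (w, s)) 2 volume := by
  filter_upwards [h₁.prod_right_ae, ((memLp_two_iff_integrable_sq_norm h₂.1).1 h₂).prod_right_ae]
    with w hw1 hw2
  exact ⟨hw1, (memLp_two_iff_integrable_sq_norm hw1.1).2 hw2⟩

theorem lintegral_enorm_fiberFT [SFinite μ] {f : α × ℝ → ℂ} (h₁ : Integrable f (μ.prod volume))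
    (h₂ : MemLp f 2 (μ.prod volume)) :
    ∫⁻ p, ‖fiberFT f p‖ₑ ^ 2 ∂(μ.prod volume) =
      ENNReal.ofReal (2 * Real.pi) * ∫⁻ p, ‖f p‖ₑ ^ 2 ∂(μ.prod volume) := by
  have hm := (aestronglyMeasurable_fiberFT h₁.1).enorm.pow_const 2
  have hm2 := h₁.1.enorm.pow_const 2
  rw [lintegral_prod _ hm, lintegral_prod _ hm2,
    ← lintegral_const_mul'' _ hm2.lintegral_prod_right']
  refine lintegral_congr_ae ?_
  filter_upwards [ae_fiber_integrable h₁ h₂] with w hw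
  exact lintegral_enorm_spectralFT hw.1 hw.2

theorem memLp_fiberFT [SFinite μ] {f : α × ℝ → ℂ} (h₁ : Integrable f (μ.prod volume))
    (h₂ : MemLp f 2 (μ.prod volume)) : MemLp (fiberFT f) 2 (μ.prod volume) := by
  rw [memLp_two_iff_lintegral (aestronglyMeasurable_fiberFT h₁.1), lintegral_enorm_fiberFT h₁ h₂]
  exact ENNReal.mul_lt_top ENNReal.ofReal_lt_top ((memLp_two_iff_lintegral h₂.1).1 h₂)

theorem fiberFT_congr [SFinite μ] {f g : α × ℝ → ℂ} (h : f =ᵐ[μ.prod volume] g) :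
    fiberFT f =ᵐ[μ.prod volume] fiberFT g := by
  have h1 := Measure.ae_ae_of_ae_prod h
  have h2 := (Measure.quasiMeasurePreserving_fst (μ := μ) (ν := (volume : Measure ℝ))).ae h1
  filter_upwards [h2] with p hp
  refine integral_congr_ae ?_
  filter_upwards [hp] with s hs
  rw [hs]

theorem fiberFT_add [SFinite μ] {f g : α × ℝ → ℂ} (hf : Integrable f (μ.prod volume))
    (hg : Integrable g (μ.prod volume)) :
    fiberFT (f + g) =ᵐ[μ.prod volume] fiberFT f + fiberFT g := by
  have h1 := (Measure.quasiMeasurePreserving_fst (μ := μ) (ν := (volume : Measure ℝ))).ae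
    (hf.prod_right_ae.and hg.prod_right_ae)
  have hexp : ∀ (lam : ℝ) {u : ℝ → ℂ}, Integrable u →
      Integrable fun s : ℝ => u s * Complex.exp (-(Complex.I * lam * s)) := by
    intro lam u hu
    have hc : Continuous fun s : ℝ => Complex.exp (-(Complex.I * lam * s)) := by fun_prop
    refine hu.mono (hu.1.mul hc.aestronglyMeasurable) (.of_forall fun s => ?_)
    rw [norm_mul, Complex.norm_exp]
    simp
  filter_upwards [h1] with p hp
  simp only [Pi.add_apply, fiberFT, spectralFT]
  rw [← integral_add (hexp p.2 hp.1) (hexp p.2 hp.2)]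
  refine integral_congr_ae (.of_forall fun s => ?_)
  simp only
  ring

variable (μ) in
/-- The subspace `L¹ ∩ L²` of `L²`. -/
def integrableL2 : Submodule ℂ (Lp ℂ 2 μ) where
  carrier := {x | Integrable x μ}
  zero_mem' := (integrable_zero α ℂ μ).congr (Lp.coeFn_zero ℂ 2 μ).symm
  add_mem' hx hy := (hx.add hy).congr (Lp.coeFn_add _ _).symm
  smul_mem' c x hx := (hx.smul c).congr (Lp.coeFn_smul c x).symm

/-- Simple functions in `L²` are integrable, and they are dense. -/
theorem denseRange_integrableL2 : DenseRange (integrableL2 μ).subtype := by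
  intro x
  rw [EMetric.mem_closure_iff]
  intro ε hε
  obtain ⟨g, hg1, hg2⟩ := (Lp.memLp x).exists_simpleFunc_eLpNorm_sub_lt (by norm_num) hε.ne'
  have hgi := (SimpleFunc.memLp_iff_integrable (p := 2) (by norm_num) (by norm_num)).1 hg2
  refine ⟨hg2.toLp g, ⟨⟨hg2.toLp g, hgi.congr hg2.coeFn_toLp.symm⟩, rfl⟩, ?_⟩
  rw [Lp.edist_def]
  refine (eLpNorm_congr_ae ?_).trans_lt hg1
  filter_upwards [hg2.coeFn_toLp] with a ha
  simp [ha]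

theorem norm_toLp_fiberFT [SFinite μ] {f : α × ℝ → ℂ} (h₁ : Integrable f (μ.prod volume))
    (h₂ : MemLp f 2 (μ.prod volume)) :
    ‖(memLp_fiberFT h₁ h₂).toLp _‖ = √(2 * Real.pi) * ‖h₂.toLp f‖ := by
  have e1 : ‖(memLp_fiberFT h₁ h₂).toLp _‖ₑ ^ 2 =
      ENNReal.ofReal (2 * Real.pi) * ‖h₂.toLp f‖ₑ ^ 2 := by
    rw [Lp.enorm_toLp, Lp.enorm_toLp, eLpNorm_two_sq, eLpNorm_two_sq, lintegral_enorm_fiberFT h₁ h₂]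
  rw [← ofReal_norm, ← ofReal_norm, ← ENNReal.ofReal_pow (norm_nonneg _),
    ← ENNReal.ofReal_pow (norm_nonneg _), ← ENNReal.ofReal_mul (by positivity),
    ENNReal.ofReal_eq_ofReal_iff (by positivity) (by positivity)] at e1
  rw [← Real.sqrt_sq (norm_nonneg ((memLp_fiberFT h₁ h₂).toLp _)), e1,
    Real.sqrt_mul (by positivity), Real.sqrt_sq (norm_nonneg _)]

/-- The Fourier transform in the last variable as a linear map on `L¹ ∩ L²`. -/
noncomputable def fiberFTLinear [SFinite μ] :
    integrableL2 (μ.prod (volume : Measure ℝ)) →ₗ[ℂ] Lp ℂ 2 (μ.prod (volume : Measure ℝ)) where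
  toFun x := (memLp_fiberFT x.2 (Lp.memLp x.1)).toLp _
  map_add' x y := by
    rw [← MemLp.toLp_add, MemLp.toLp_eq_toLp_iff]
    exact (fiberFT_congr (Lp.coeFn_add x.1 y.1)).trans (fiberFT_add x.2 y.2)
  map_smul' c x := by
    rw [RingHom.id_apply, ← MemLp.toLp_const_smul, MemLp.toLp_eq_toLp_iff]
    exact (fiberFT_congr (Lp.coeFn_smul c x.1)).trans (.of_forall (fiberFT_smul c x.1))

theorem norm_fiberFTLinear [SFinite μ] (x : integrableL2 (μ.prod (volume : Measure ℝ))) :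
    ‖fiberFTLinear x‖ = √(2 * Real.pi) * ‖(x : Lp ℂ 2 (μ.prod (volume : Measure ℝ)))‖ := by
  have h := norm_toLp_fiberFT x.2 (Lp.memLp x.1)
  rw [Lp.toLp_coeFn] at h
  exact h

variable (μ) in
/-- The Fourier transform in the last variable on `L²`. -/
noncomputable def fiberFTL [SFinite μ] :
    Lp ℂ 2 (μ.prod (volume : Measure ℝ)) →L[ℂ] Lp ℂ 2 (μ.prod (volume : Measure ℝ)) :=
  fiberFTLinear.extendOfNorm (integrableL2 (μ.prod volume)).subtype

theorem fiberFTL_apply_coe [SFinite μ] (x : integrableL2 (μ.prod (volume : Measure ℝ))) :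
    fiberFTL μ x = fiberFTLinear x :=
  LinearMap.extendOfNorm_eq denseRange_integrableL2
    ⟨√(2 * Real.pi), fun x => (norm_fiberFTLinear x).le⟩ x

theorem norm_fiberFTL [SFinite μ] (x : Lp ℂ 2 (μ.prod (volume : Measure ℝ))) :
    ‖fiberFTL μ x‖ = √(2 * Real.pi) * ‖x‖ := by
  refine denseRange_integrableL2.induction_on
    (p := fun x => ‖fiberFTL μ x‖ = √(2 * Real.pi) * ‖x‖) x ?_ fun y => ?_
  · exact isClosed_eq (fiberFTL μ).continuous.norm (continuous_const.mul continuous_norm)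
  · exact (congrArg norm (fiberFTL_apply_coe y)).trans (norm_fiberFTLinear y)

theorem fiberFTL_toLp [SFinite μ] {f : α × ℝ → ℂ} (h₁ : Integrable f (μ.prod volume))
    (h₂ : MemLp f 2 (μ.prod volume)) :
    fiberFTL μ (h₂.toLp f) =ᵐ[μ.prod volume] fiberFT f := by
  have h3 : fiberFTL μ (h₂.toLp f) =
    fiberFTLinear ⟨h₂.toLp f, h₁.congr h₂.coeFn_toLp.symm⟩ :=
      fiberFTL_apply_coe (μ := μ) ⟨h₂.toLp f, h₁.congr h₂.coeFn_toLp.symm⟩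
  rw [h3]
  exact (MemLp.coeFn_toLp (memLp_fiberFT (h₁.congr h₂.coeFn_toLp.symm)
    (Lp.memLp (h₂.toLp f)))).trans (fiberFT_congr h₂.coeFn_toLp)

/-- Rectangles form a π-system generating the product σ-algebra, and the sets on which `g`
integrates to zero are stable under complements and countable disjoint unions. -/
theorem ae_eq_zero_of_setIntegral_prod_eq_zero {β : Type*} [MeasurableSpace β] {ν : Measure β}
    [IsFiniteMeasure μ] [IsFiniteMeasure ν] {g : α × β → ℂ} (hg : Integrable g (μ.prod ν))
    (h : ∀ A B, MeasurableSet A → MeasurableSet B → ∫ p in A ×ˢ B, g p ∂(μ.prod ν) = 0) :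
    g =ᵐ[μ.prod ν] 0 := by
  refine hg.ae_eq_zero_of_forall_setIntegral_eq_zero fun s hs _ => ?_
  have huniv : ∫ p, g p ∂(μ.prod ν) = 0 := by
    have := h Set.univ Set.univ .univ .univ
    rwa [Set.univ_prod_univ, setIntegral_univ] at this
  induction s, hs using MeasurableSpace.induction_on_inter generateFrom_prod.symm isPiSystem_prod
    with
  | empty => simp
  | basic t ht =>
    obtain ⟨A, hA, B, hB, rfl⟩ := ht
    exact h A B hA hB
  | compl t ht ih =>
    have := integral_add_compl ht hg
    rw [ih (measure_lt_top _ _), zero_add] at this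
    rw [this, huniv]
  | iUnion t hd ht ih =>
    rw [integral_iUnion ht hd hg.integrableOn]
    simp [fun i => ih i (measure_lt_top _ _)]

open FourierTransform in
-- The preimage is `1_A ⊗ ψ` with `ψ` the inverse Fourier transform of `u(2π·)`; the dilation
-- compensates for the two normalisations.
theorem exists_fiberFTL_eq_tensor [SFinite μ] {A : Set α} (hA : MeasurableSet A) (hμA : μ A < ⊤)
    {u : ℝ → ℝ} (hu : ContDiff ℝ ((⊤ : ℕ∞) : WithTop ℕ∞) u) (hc : HasCompactSupport u) :
    ∃ x, fiberFTL μ x =ᵐ[μ.prod volume] fun p => A.indicator (fun _ => (1 : ℂ)) p.1 * u p.2 := by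
  have hpi : (2 * Real.pi) ≠ 0 := by positivity
  have h₁ : HasCompactSupport (Complex.ofRealCLM ∘ fun x => u ((2 * Real.pi) • x)) :=
    (hc.comp_smul hpi).comp_left rfl
  have h₂ : ContDiff ℝ ((⊤ : ℕ∞) : WithTop ℕ∞)
      (Complex.ofRealCLM ∘ fun x => u ((2 * Real.pi) • x)) := by fun_prop
  let S := h₁.toSchwartzMap h₂
  let ψ : SchwartzMap ℝ ℂ := 𝓕⁻ S
  have hψ : ∀ lam, spectralFT ψ lam = u lam := by
    intro lam
    rw [spectralFT_eq, ← SchwartzMap.fourier_coe, FourierTransform.fourier_fourierInv_eq]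
    change ((u ((2 * Real.pi) • ((2 * Real.pi)⁻¹ * lam)) : ℝ) : ℂ) = _
    rw [smul_eq_mul, mul_inv_cancel_left₀ hpi]
  have hψ1 : Integrable ψ := ψ.integrable
  have hψ2 := (memLp_two_iff_integrable_sq_norm hψ1.1).1 (ψ.memLp 2 volume)
  have hAi : Integrable (A.indicator fun _ => (1 : ℂ)) μ :=
    (integrable_indicator_iff hA).2 (integrableOn_const hμA.ne)
  have hA2 : Integrable (fun w => ‖A.indicator (fun _ => (1 : ℂ)) w‖ ^ 2) μ := by
    refine hAi.norm.congr (.of_forall fun w => ?_)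
    by_cases hw : w ∈ A <;> simp [hw]
  have hf1 : Integrable (fun p : α × ℝ => A.indicator (fun _ => (1 : ℂ)) p.1 * ψ p.2)
      (μ.prod volume) := hAi.mul_prod hψ1
  have hf2 : MemLp (fun p : α × ℝ => A.indicator (fun _ => (1 : ℂ)) p.1 * ψ p.2) 2
      (μ.prod volume) := by
    rw [memLp_two_iff_integrable_sq_norm hf1.1]
    simp_rw [norm_mul, mul_pow]
    exact hA2.mul_prod hψ2
  refine ⟨hf2.toLp _, (fiberFTL_toLp hf1 hf2).trans (.of_forall fun p => ?_)⟩
  simp only [fiberFT]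
  rw [← hψ p.2, spectralFT, spectralFT, ← integral_const_mul]
  refine integral_congr_ae (.of_forall fun s => ?_)
  simp only
  ring

/-- For fixed `A`, varying `u` shows that the integral of `g(·,λ)` over `A` vanishes for almost
every `λ`. Integrating over `λ ∈ B` treats rectangles of finite measure, and σ-finiteness exhausts
the space. -/
theorem ae_eq_zero_of_integral_tensor_eq_zero [SigmaFinite μ] {g : α × ℝ → ℂ}
    (hg : MemLp g 2 (μ.prod volume))
    (h : ∀ (A : Set α) (u : ℝ → ℝ), MeasurableSet A → μ A < ⊤ →
      ContDiff ℝ ((⊤ : ℕ∞) : WithTop ℕ∞) u → HasCompactSupport u →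
      ∫ p, A.indicator (fun _ => (1 : ℂ)) p.1 * u p.2 * g p ∂(μ.prod volume) = 0) :
    g =ᵐ[μ.prod volume] 0 := by
  have hint : ∀ (A : Set α) (B : Set ℝ), μ A < ⊤ → volume B < ⊤ →
      Integrable g ((μ.restrict A).prod (volume.restrict B)) := by
    intro A B hA hB
    have : IsFiniteMeasure (μ.restrict A) := ⟨by simpa using hA⟩
    have : IsFiniteMeasure ((volume : Measure ℝ).restrict B) := ⟨by simpa using hB⟩
    rw [Measure.prod_restrict]
    have h1 : MemLp g 2 ((μ.prod volume).restrict (A ×ˢ B)) := hg.restrict _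
    rw [← Measure.prod_restrict] at h1 ⊢
    exact h1.integrable (by norm_num)
  have hslice : ∀ A : Set α, MeasurableSet A → μ A < ⊤ →
      ∀ᵐ lam : ℝ, ∫ w in A, g (w, lam) ∂μ = 0 := by
    intro A hA hμA
    refine ae_eq_zero_of_integral_contDiff_smul_eq_zero ?_ fun u hu hc => ?_
    · rw [locallyIntegrable_iff]
      intro K hK
      exact (hint A K hμA hK.measure_lt_top).integral_prod_right
    · have hI : Integrable (fun p : α × ℝ => (u p.2 : ℂ) * g p) ((μ.restrict A).prod volume) := by
        have h1 : MemLp g 2 ((μ.restrict A).prod volume) := by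
          have h2 : MemLp g 2 ((μ.prod volume).restrict (A ×ˢ Set.univ)) := hg.restrict _
          rwa [← Measure.prod_restrict, Measure.restrict_univ] at h2
        have : IsFiniteMeasure (μ.restrict A) := ⟨by simpa using hμA⟩
        have hu2 : MemLp (fun x => (u x : ℂ)) 2 volume :=
          (Complex.continuous_ofReal.comp hu.continuous).memLp_of_hasCompactSupport
            (hc.comp_left (g := ((↑) : ℝ → ℂ)) Complex.ofReal_zero)
        exact (hu2.comp_snd (μ.restrict A)).integrable_mul h1
      have h3 := h A u hA hμA hu hc
      have h4 : ∫ p, A.indicator (fun _ => (1 : ℂ)) p.1 * u p.2 * g p ∂(μ.prod volume) =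
          ∫ p, (u p.2 : ℂ) * g p ∂((μ.restrict A).prod volume) := by
        have e : (μ.restrict A).prod (volume : Measure ℝ) =
            (μ.prod volume).restrict (A ×ˢ Set.univ) := by
          rw [← Measure.prod_restrict, Measure.restrict_univ]
        rw [e, ← integral_indicator (hA.prod .univ)]
        refine integral_congr_ae (.of_forall fun p => ?_)
        by_cases hp : p.1 ∈ A <;> simp [Set.indicator, hp]
      rw [h4, integral_prod_symm _ hI] at h3
      rw [← h3]
      refine integral_congr_ae (.of_forall fun lam => ?_)
      simp only
      rw [integral_const_mul, Complex.real_smul]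
  have hrect : ∀ (A : Set α) (B : Set ℝ), MeasurableSet A → μ A < ⊤ → MeasurableSet B →
      volume B < ⊤ → ∫ p, g p ∂((μ.restrict A).prod (volume.restrict B)) = 0 := by
    intro A B hA hμA hB hνB
    rw [integral_prod_symm _ (hint A B hμA hνB)]
    exact integral_eq_zero_of_ae (ae_restrict_of_ae (hslice A hA hμA))
  have hloc : ∀ i j, ∀ᵐ p ∂((μ.prod volume).restrict
      (spanningSets μ i ×ˢ spanningSets (volume : Measure ℝ) j)), g p = 0 := by
    intro i j
    have hA := measurableSet_spanningSets μ i
    have hB := measurableSet_spanningSets (volume : Measure ℝ) j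
    have hA' := measure_spanningSets_lt_top μ i
    have hB' := measure_spanningSets_lt_top (volume : Measure ℝ) j
    have : IsFiniteMeasure (μ.restrict (spanningSets μ i)) := ⟨by simpa using hA'⟩
    have : IsFiniteMeasure ((volume : Measure ℝ).restrict (spanningSets volume j)) :=
      ⟨by simpa using hB'⟩
    rw [← Measure.prod_restrict]
    refine ae_eq_zero_of_setIntegral_prod_eq_zero (hint _ _ hA' hB') fun A B hA2 hB2 => ?_
    rw [← Measure.prod_restrict, Measure.restrict_restrict hA2, Measure.restrict_restrict hB2]
    exact hrect _ _ (hA2.inter hA) ((measure_mono Set.inter_subset_right).trans_lt hA')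
      (hB2.inter hB) ((measure_mono Set.inter_subset_right).trans_lt hB')
  have hU : (⋃ q : ℕ × ℕ, spanningSets μ q.1 ×ˢ spanningSets (volume : Measure ℝ) q.2) =
      Set.univ := by
    refine Set.eq_univ_of_forall fun p => ?_
    obtain ⟨i, hi⟩ := Set.mem_iUnion.1 ((iUnion_spanningSets μ).symm ▸ Set.mem_univ p.1)
    obtain ⟨j, hj⟩ := Set.mem_iUnion.1
      ((iUnion_spanningSets (volume : Measure ℝ)).symm ▸ Set.mem_univ p.2)
    exact Set.mem_iUnion.2 ⟨(i, j), hi, hj⟩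
  have h5 := (ae_restrict_iUnion_iff (μ := μ.prod (volume : Measure ℝ))
    (fun q : ℕ × ℕ => spanningSets μ q.1 ×ˢ spanningSets (volume : Measure ℝ) q.2)
    (fun p => g p = 0)).2 fun q => hloc q.1 q.2
  rwa [hU, Measure.restrict_univ] at h5

theorem isClosed_range_of_norm_eq {E F : Type*} [NormedAddCommGroup E] [NormedSpace ℂ E]
    [CompleteSpace E] [NormedAddCommGroup F] [NormedSpace ℂ F] (T : E →L[ℂ] F) {c : ℝ}
    (hc : 0 < c) (hT : ∀ x, ‖T x‖ = c * ‖x‖) : IsClosed (Set.range T) := by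
  refine AntilipschitzWith.isClosed_range (K := (c⁻¹).toNNReal) ?_ T.uniformContinuous
  refine AddMonoidHomClass.antilipschitz_of_bound T fun x => ?_
  rw [hT, Real.coe_toNNReal _ (by positivity), inv_mul_cancel_left₀ hc.ne']

/-- The range is closed, hence equal to its double orthogonal complement. Only the given `y` is
tested, so it applies to `y ∈ L²₀` before `L²₀` is known to be closed. -/
theorem surjective_of_orthogonal_range {E F : Type*} [NormedAddCommGroup E] [NormedSpace ℂ E]
    [CompleteSpace E] [NormedAddCommGroup F] [InnerProductSpace ℂ F] [CompleteSpace F]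
    (T : E →L[ℂ] F) {c : ℝ} (hc : 0 < c) (hT : ∀ x, ‖T x‖ = c * ‖x‖) {y : F}
    (hy : ∀ z, (∀ x, inner ℂ (T x) z = 0) → inner ℂ y z = 0) : ∃ x, T x = y := by
  have hcl := isClosed_range_of_norm_eq T hc hT
  have hcl' : IsClosed ((LinearMap.range (T : E →ₗ[ℂ] F) : Submodule ℂ F) : Set F) := hcl
  have : CompleteSpace (LinearMap.range (T : E →ₗ[ℂ] F) : Submodule ℂ F) := hcl'.completeSpace_coe
  have h1 : y ∈ (LinearMap.range (T : E →ₗ[ℂ] F) : Submodule ℂ F)ᗮᗮ := by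
    rw [Submodule.mem_orthogonal']
    intro z hz
    exact hy z fun x => (Submodule.mem_orthogonal _ _).1 hz _ ⟨x, rfl⟩
  rw [Submodule.orthogonal_orthogonal] at h1
  exact h1

theorem fiberFTL_surjective [SigmaFinite μ] : Function.Surjective (fiberFTL μ) := by
  intro y
  refine surjective_of_orthogonal_range (fiberFTL μ) (c := √(2 * Real.pi)) (by positivity)
    norm_fiberFTL fun z hz => ?_
  have : z = 0 := by
    rw [Lp.eq_zero_iff_ae_eq_zero]
    refine ae_eq_zero_of_integral_tensor_eq_zero (Lp.memLp z) fun A u hA hμA hu hc => ?_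
    obtain ⟨x, hx⟩ := exists_fiberFTL_eq_tensor hA hμA hu hc
    have h1 := hz x
    rw [L2.inner_def] at h1
    rw [← h1]
    refine integral_congr_ae ?_
    filter_upwards [hx] with p hp
    rw [hp, RCLike.inner_apply]
    by_cases hpA : p.1 ∈ A <;> simp [hpA, mul_comm]
  rw [this, inner_zero_right]

end FiberFT

/-! ### Measure theory on the fan and the Laguerre transform as a scaled isometry. -/

theorem measurableSet_fanRay (n k : ℕ) : MeasurableSet (fanRay n k) :=
  measurableSet_eq_fun measurable_snd (by fun_prop)

theorem measurable_fanIndex {n : ℕ} : Measurable (fanIndex : heisFan n → ℕ) := by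
  have hR : ∀ j, MeasurableSet {a : heisFan n | (a : ℝ × ℝ) ∈ fanRay n j} := fun j =>
    measurable_subtype_coe (measurableSet_fanRay n j)
  refine measurable_of_Ioi fun k => ?_
  -- The existence clause excludes the points `(0,τ)` that lie on no ray `R_j`: there the infimum of
  -- the empty set is `0`.
  have e : fanIndex ⁻¹' Set.Ioi k = {a : heisFan n | (∀ j ≤ k, (a : ℝ × ℝ) ∉ fanRay n j) ∧
      ∃ j, (a : ℝ × ℝ) ∈ fanRay n j} := by
    ext a
    simp only [Set.mem_preimage, Set.mem_Ioi, Set.mem_ofPred_eq, fanIndex]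
    constructor
    · intro h
      have hne : {k : ℕ | (a : ℝ × ℝ) ∈ fanRay n k}.Nonempty := by
        by_contra hcon
        rw [Set.not_nonempty_iff_eq_empty.1 hcon, Nat.sInf_empty] at h
        omega
      exact ⟨fun j hj hmem => h.not_ge ((Nat.sInf_le hmem).trans hj), hne⟩
    · rintro ⟨h1, h3⟩
      by_contra hcon
      exact h1 _ (not_lt.1 hcon) (Nat.sInf_mem h3)
  rw [e]
  have e2 : {a : heisFan n | (∀ j ≤ k, (a : ℝ × ℝ) ∉ fanRay n j) ∧
      ∃ j, (a : ℝ × ℝ) ∈ fanRay n j} =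
      (⋂ j ∈ Set.Iic k, {a : heisFan n | (a : ℝ × ℝ) ∈ fanRay n j}ᶜ) ∩
      ⋃ j, {a : heisFan n | (a : ℝ × ℝ) ∈ fanRay n j} := by
    ext a
    simp
  rw [e2]
  exact (MeasurableSet.biInter (Set.to_countable _) fun j _ => (hR j).compl).inter
    (MeasurableSet.iUnion hR)

theorem eq_fanPoint_fanIndex {n : ℕ} {a : heisFan n} (h : a.1.1 ≠ 0) :
    fanPoint n (fanIndex a) a.1.1 = a := by
  have hne : {k : ℕ | (a : ℝ × ℝ) ∈ fanRay n k}.Nonempty := by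
    rcases a.2 with h1 | h1
    · exact Set.mem_iUnion.1 h1
    · exact absurd h1.1 h
  have h2 : (a : ℝ × ℝ) ∈ fanRay n (fanIndex a) := Nat.sInf_mem hne
  refine Subtype.ext (Prod.ext rfl ?_)
  exact h2.symm

theorem fanMeasure_ae_of_ae (n : ℕ) {P : ℝ → Prop} (h : ∀ᵐ lam : ℝ, P lam) :
    ∀ᵐ a ∂(fanMeasure n), P a.1.1 := by
  obtain ⟨t, hst, htm, ht0⟩ := exists_measurable_superset_of_null (ae_iff.1 h)
  set s := tᶜ
  have hs2 : MeasurableSet s := htm.compl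
  have hs3 : ∀ᵐ lam : ℝ, lam ∈ s := measure_eq_zero_iff_ae_notMem.1 ht0
  have hm : MeasurableSet {a : heisFan n | a.1.1 ∈ s} :=
    (measurable_fst.comp measurable_subtype_coe) hs2
  have : ∀ᵐ a ∂(fanMeasure n), a.1.1 ∈ s := by
    rw [fanMeasure, Measure.ae_sum_iff' hm]
    intro k
    rw [ae_map_iff (measurable_fanPoint n k).aemeasurable hm]
    exact (withDensity_absolutelyContinuous _ _).ae_le hs3
  filter_upwards [this] with a ha
  exact not_not.1 fun hP => ha (hst hP)

/-- On each ray `ν` has a density that is positive for `λ ≠ 0`, so `ν`-null sets pull back to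
Lebesgue-null sets of `λ`. -/
theorem ae_fanPoint_of_ae {n : ℕ} {P : heisFan n → Prop} (h : ∀ᵐ a ∂(fanMeasure n), P a) (k : ℕ) :
    ∀ᵐ lam : ℝ, P (fanPoint n k lam) := by
  rw [fanMeasure] at h
  have h1 := ae_of_ae_map (measurable_fanPoint n k).aemeasurable (Measure.ae_sum_iff.1 h k)
  rw [ae_withDensity_iff (by fun_prop)] at h1
  have h0 : ∀ᵐ lam : ℝ, lam ≠ 0 :=
    measure_eq_zero_iff_ae_notMem.1 (Real.volume_singleton (a := 0))
  filter_upwards [h1, h0] with lam h2 h3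
  refine h2 ?_
  have : 0 < |lam| := abs_pos.2 h3
  exact (ENNReal.ofReal_pos.2 (by positivity)).ne'

theorem fanMeasure_prod_ae {n : ℕ} {P : heisFan n → Prop} (h : ∀ᵐ a ∂(fanMeasure n), P a) :
    ∀ᵐ p ∂((fanMeasure n).prod (volume : Measure (Fin n → ℂ))), P p.1 :=
  Measure.quasiMeasurePreserving_fst.ae h

/-- The fibrewise Laguerre expansion `(λ, k, z) ↦ (φ_{k,λ} *_λ g(·, λ))(z)`. -/
noncomputable def laguerreTransform {n : ℕ} (g : (Fin n → ℂ) × ℝ → ℂ)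
    (p : heisFan n × (Fin n → ℂ)) : ℂ :=
  twistedConv p.1.1.1 (fun w => (laguerreFun n (fanIndex p.1) p.1.1.1 w : ℂ))
    (fun w => g (w, p.1.1.1)) p.2

theorem stronglyMeasurable_laguerreTransform {n : ℕ} {g : (Fin n → ℂ) × ℝ → ℂ}
    (hg : StronglyMeasurable g) : StronglyMeasurable (laguerreTransform g) := by
  have h1 : Measurable fun q : ℕ × (ℝ × (Fin n → ℂ)) => laguerreFun n q.1 q.2.1 q.2.2 := by
    refine measurable_from_prod_countable_right fun k => Continuous.measurable ?_
    change Continuous fun q : ℝ × (Fin n → ℂ) => laguerreFun n k q.1 q.2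
    unfold laguerreFun laguerreL normSqC
    fun_prop
  have h2 : Measurable fun q : ℝ × (Fin n → ℂ) × (Fin n → ℂ) =>
      Complex.exp (Complex.I / 2 * q.1 * imDot q.2.1 q.2.2) := by
    refine Continuous.measurable ?_
    unfold imDot
    fun_prop
  have hlam : Measurable fun q : (heisFan n × (Fin n → ℂ)) × (Fin n → ℂ) => q.1.1.1.1 :=
    measurable_fst.comp (measurable_subtype_coe.comp (measurable_fst.comp measurable_fst))
  have hidx : Measurable fun q : (heisFan n × (Fin n → ℂ)) × (Fin n → ℂ) => fanIndex q.1.1 :=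
    measurable_fanIndex.comp (measurable_fst.comp measurable_fst)
  have hz : Measurable fun q : (heisFan n × (Fin n → ℂ)) × (Fin n → ℂ) => q.1.2 :=
    measurable_snd.comp measurable_fst
  have hA := Complex.measurable_ofReal.comp
    (h1.comp (hidx.prodMk (hlam.prodMk (hz.sub measurable_snd))))
  have hB : StronglyMeasurable fun q : (heisFan n × (Fin n → ℂ)) × (Fin n → ℂ) =>
      g (q.2, q.1.1.1.1) := hg.comp_measurable (measurable_snd.prodMk hlam)
  have hC : Measurable fun q : (heisFan n × (Fin n → ℂ)) × (Fin n → ℂ) =>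
      Complex.exp (Complex.I / 2 * q.1.1.1.1 * imDot q.1.2 q.2) :=
    h2.comp (hlam.prodMk (hz.prodMk measurable_snd))
  have hD : StronglyMeasurable fun q : (heisFan n × (Fin n → ℂ)) × (Fin n → ℂ) =>
      (laguerreFun n (fanIndex q.1.1) q.1.1.1.1 (q.1.2 - q.2) : ℂ) * g (q.2, q.1.1.1.1) *
        Complex.exp (Complex.I / 2 * q.1.1.1.1 * imDot q.1.2 q.2) :=
    (hA.stronglyMeasurable.mul hB).mul hC.stronglyMeasurable
  exact hD.integral_prod_right'

theorem laguerreTransform_congr {n : ℕ} {g₁ g₂ : (Fin n → ℂ) × ℝ → ℂ}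
    (h : g₁ =ᵐ[volume.prod volume] g₂) :
    laguerreTransform g₁ =ᵐ[(fanMeasure n).prod volume] laguerreTransform g₂ := by
  have h1 : ∀ᵐ lam : ℝ, ∀ᵐ w : Fin n → ℂ, g₁ (w, lam) = g₂ (w, lam) :=
    Measure.ae_ae_of_ae_prod ((Measure.measurePreserving_swap (μ := (volume : Measure ℝ))
      (ν := (volume : Measure (Fin n → ℂ)))).quasiMeasurePreserving.ae h)
  filter_upwards [fanMeasure_prod_ae (fanMeasure_ae_of_ae n h1)] with p hp
  exact twistedConv_congr _ _ hp _

theorem ae_memLp_slice {n : ℕ} {g : (Fin n → ℂ) × ℝ → ℂ} (hm : StronglyMeasurable g)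
    (hg : MemLp g 2 (volume.prod volume)) :
    ∀ᵐ lam : ℝ, MemLp (fun w => g (w, lam)) 2 volume := by
  filter_upwards [((memLp_two_iff_integrable_sq_norm hg.1).1 hg).prod_left_ae] with lam h
  exact (memLp_two_iff_integrable_sq_norm
    (hm.comp_measurable (measurable_id.prodMk measurable_const)).aestronglyMeasurable).2 h

theorem lintegral_enorm_sq {α : Type*} [MeasurableSpace α] {μ : Measure α} {f : α → ℂ}
    (hf : MemLp f 2 μ) : ∫⁻ a, ‖f a‖ₑ ^ 2 ∂μ = ENNReal.ofReal (∫ a, ‖f a‖ ^ 2 ∂μ) := by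
  rw [ofReal_integral_eq_lintegral_ofReal ((memLp_two_iff_integrable_sq_norm hf.1).1 hf)
    (.of_forall fun a => sq_nonneg _)]
  refine lintegral_congr fun a => ?_
  rw [ENNReal.ofReal_pow (norm_nonneg _), ofReal_norm]

theorem tsum_lintegral_twistedConv_laguerreFun {n : ℕ} (hn : 1 ≤ n) {lam : ℝ} (hl : lam ≠ 0)
    {h : (Fin n → ℂ) → ℂ} (hh : MemLp h 2 volume) :
    ∑' k, ∫⁻ z, ‖twistedConv lam (fun w => (laguerreFun n k lam w : ℂ)) h z‖ₑ ^ 2 =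
      ENNReal.ofReal (((2 * Real.pi / |lam|) ^ n) ^ 2) * ∫⁻ z, ‖h z‖ₑ ^ 2 := by
  have h1 := hasSum_norm_twistedConv_laguerreFun hn hl hh
  have h2 := fun k => lintegral_enorm_sq
    ((isTwistKernel_laguerreFun hn k hl).memLp_twistedConv lam hh)
  simp_rw [h2]
  rw [← ENNReal.ofReal_tsum_of_nonneg (fun k => integral_nonneg fun z => sq_nonneg _) h1.summable,
    h1.tsum_eq, ENNReal.ofReal_mul (by positivity), lintegral_enorm_sq hh]

theorem laguerreTransform_fanPoint {n : ℕ} (g : (Fin n → ℂ) × ℝ → ℂ) (k : ℕ) {lam : ℝ}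
    (hl : lam ≠ 0) (z : Fin n → ℂ) :
    laguerreTransform g (fanPoint n k lam, z) =
      twistedConv lam (fun w => (laguerreFun n k lam w : ℂ)) (fun w => g (w, lam)) z := by
  rw [laguerreTransform, fanIndex_fanPoint n k hl]
  rfl

theorem lintegral_fanMeasure_prod (n : ℕ) {F : heisFan n × (Fin n → ℂ) → ENNReal}
    (hF : Measurable F) :
    ∫⁻ p, F p ∂((fanMeasure n).prod volume) =
      ENNReal.ofReal (((2 * Real.pi) ^ (2 * n + 1))⁻¹) *
        ∫⁻ lam : ℝ, (∑' k : ℕ, ∫⁻ z, F (fanPoint n k lam, z)) *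
          ENNReal.ofReal (|lam| ^ (2 * n)) := by
  rw [lintegral_prod _ hF.aemeasurable, lintegral_fanMeasure n hF.lintegral_prod_right']

/-- In each fibre `(2π/|λ|)^(2n)` cancels the weight `|λ|^(2n)`, leaving `(2π)^(2n)`; the constant
`(2π)^(-2n-1)` of `ν` reduces this to `(2π)^(-1)`. -/
theorem lintegral_enorm_laguerreTransform {n : ℕ} (hn : 1 ≤ n) {g : (Fin n → ℂ) × ℝ → ℂ}
    (hm : StronglyMeasurable g) (hg : MemLp g 2 (volume.prod volume)) :
    ∫⁻ p, ‖laguerreTransform g p‖ₑ ^ 2 ∂((fanMeasure n).prod volume) =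
      ENNReal.ofReal (2 * Real.pi)⁻¹ * ∫⁻ p, ‖g p‖ₑ ^ 2 ∂(volume.prod volume) := by
  have hT := (stronglyMeasurable_laguerreTransform hm).measurable.enorm.pow_const 2
  have hg2 : Measurable fun p => ‖g p‖ₑ ^ 2 := hm.measurable.enorm.pow_const 2
  have h0 : ∀ᵐ lam : ℝ, lam ≠ 0 :=
    measure_eq_zero_iff_ae_notMem.1 (Real.volume_singleton (a := 0))
  have h1 : ∫⁻ lam : ℝ, (∑' k : ℕ, ∫⁻ z, ‖laguerreTransform g (fanPoint n k lam, z)‖ₑ ^ 2) *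
      ENNReal.ofReal (|lam| ^ (2 * n)) =
      ∫⁻ lam : ℝ, ENNReal.ofReal ((2 * Real.pi) ^ (2 * n)) * ∫⁻ w, ‖g (w, lam)‖ₑ ^ 2 := by
    refine lintegral_congr_ae ?_
    filter_upwards [h0, ae_memLp_slice hm hg] with lam hl hs
    simp_rw [laguerreTransform_fanPoint g _ hl]
    rw [tsum_lintegral_twistedConv_laguerreFun hn hl hs, mul_right_comm,
      ← ENNReal.ofReal_mul (by positivity)]
    congr 2
    have : 0 < |lam| := abs_pos.2 hl
    rw [div_pow, div_pow, ← pow_mul, ← pow_mul, mul_comm n 2]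
    field_simp
  rw [lintegral_fanMeasure_prod n hT, h1, lintegral_const_mul _ hg2.lintegral_prod_left',
    lintegral_prod_symm _ hg2.aemeasurable, ← mul_assoc, ← ENNReal.ofReal_mul (by positivity)]
  congr 2
  rw [pow_succ]
  field_simp

theorem memLp_laguerreTransform {n : ℕ} (hn : 1 ≤ n)
    (g : Lp ℂ 2 ((volume : Measure (Fin n → ℂ)).prod (volume : Measure ℝ))) :
    MemLp (laguerreTransform (n := n) g) 2 ((fanMeasure n).prod volume) := by
  rw [memLp_two_iff_lintegral
    (stronglyMeasurable_laguerreTransform (Lp.stronglyMeasurable g)).aestronglyMeasurable,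
    lintegral_enorm_laguerreTransform hn (Lp.stronglyMeasurable g) (Lp.memLp g)]
  exact ENNReal.mul_lt_top ENNReal.ofReal_lt_top
    ((memLp_two_iff_lintegral (Lp.memLp g).1).1 (Lp.memLp g))

theorem laguerreTransform_add {n : ℕ} (hn : 1 ≤ n)
    (g₁ g₂ : Lp ℂ 2 ((volume : Measure (Fin n → ℂ)).prod (volume : Measure ℝ))) :
    laguerreTransform (n := n) (g₁ + g₂ : (Fin n → ℂ) × ℝ → ℂ) =ᵐ[(fanMeasure n).prod volume]
      laguerreTransform (n := n) g₁ + laguerreTransform (n := n) g₂ := by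
  filter_upwards [fanMeasure_prod_ae (ae_fan_ne_zero n),
    fanMeasure_prod_ae (fanMeasure_ae_of_ae n (ae_memLp_slice (Lp.stronglyMeasurable g₁)
      (Lp.memLp g₁))),
    fanMeasure_prod_ae (fanMeasure_ae_of_ae n (ae_memLp_slice (Lp.stronglyMeasurable g₂)
      (Lp.memLp g₂)))] with p h0 h1 h2
  exact (isTwistKernel_laguerreFun hn (fanIndex p.1) h0).twistedConv_add _ h1 h2 _

theorem laguerreTransform_smul {n : ℕ} (c : ℂ) (g : (Fin n → ℂ) × ℝ → ℂ)
    (p : heisFan n × (Fin n → ℂ)) :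
    laguerreTransform (c • g) p = c * laguerreTransform g p :=
  twistedConv_const_mul_right _ c _ _ _

/-- The fibrewise Laguerre expansion as a linear map between `L²` spaces. -/
noncomputable def laguerreLinear {n : ℕ} (hn : 1 ≤ n) :
    Lp ℂ 2 ((volume : Measure (Fin n → ℂ)).prod (volume : Measure ℝ)) →ₗ[ℂ] L2Fan n where
  toFun g := (memLp_laguerreTransform hn g).toLp _
  map_add' g₁ g₂ := by
    rw [← MemLp.toLp_add, MemLp.toLp_eq_toLp_iff]
    exact (laguerreTransform_congr (Lp.coeFn_add g₁ g₂)).trans (laguerreTransform_add hn g₁ g₂)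
  map_smul' c g := by
    rw [RingHom.id_apply, ← MemLp.toLp_const_smul, MemLp.toLp_eq_toLp_iff]
    exact (laguerreTransform_congr (Lp.coeFn_smul c g)).trans
      (.of_forall (laguerreTransform_smul c g))

theorem coeFn_laguerreLinear {n : ℕ} (hn : 1 ≤ n)
    (g : Lp ℂ 2 ((volume : Measure (Fin n → ℂ)).prod (volume : Measure ℝ))) :
    laguerreLinear hn g =ᵐ[(fanMeasure n).prod volume] laguerreTransform (n := n) g :=
  MemLp.coeFn_toLp (memLp_laguerreTransform hn g)

theorem norm_laguerreLinear {n : ℕ} (hn : 1 ≤ n)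
    (g : Lp ℂ 2 ((volume : Measure (Fin n → ℂ)).prod (volume : Measure ℝ))) :
    ‖laguerreLinear hn g‖ = (√(2 * Real.pi))⁻¹ * ‖g‖ := by
  have e1 : ‖laguerreLinear hn g‖ₑ ^ 2 = ENNReal.ofReal (2 * Real.pi)⁻¹ * ‖g‖ₑ ^ 2 := by
    rw [enorm_sq_eq_lintegral g, ← lintegral_enorm_laguerreTransform hn (Lp.stronglyMeasurable g)
      (Lp.memLp g), enorm_sq_eq_lintegral]
    refine lintegral_congr_ae ?_
    filter_upwards [coeFn_laguerreLinear hn g] with p hp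
    rw [hp]
  rw [← ofReal_norm, ← ofReal_norm, ← ENNReal.ofReal_pow (norm_nonneg _),
    ← ENNReal.ofReal_pow (norm_nonneg _), ← ENNReal.ofReal_mul (by positivity),
    ENNReal.ofReal_eq_ofReal_iff (by positivity) (by positivity)] at e1
  rw [← Real.sqrt_sq (norm_nonneg (laguerreLinear hn g)), e1,
    Real.sqrt_mul (by positivity), Real.sqrt_sq (norm_nonneg _), Real.sqrt_inv]

/-! ### The range of the Laguerre transform is `L²₀`. -/

theorem fanRepro_eq_of_twistedConv {n : ℕ} {a : heisFan n} (h : a.1.1 ≠ 0)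
    (g : (Fin n → ℂ) → ℂ) (z : Fin n → ℂ) :
    ((2 * Real.pi / |a.1.1|) ^ n : ℝ) * fanRepro a g z =
      twistedConv a.1.1 (fun w => (laguerreFun n (fanIndex a) a.1.1 w : ℂ)) g z := by
  have : 0 < |a.1.1| := abs_pos.2 h
  rw [fanRepro, ← mul_assoc, ← Complex.ofReal_mul]
  have e : (2 * Real.pi / |a.1.1|) ^ n * (((2 * Real.pi) ^ n)⁻¹ * |a.1.1| ^ n) = 1 := by
    rw [div_pow]
    field_simp
  rw [e, Complex.ofReal_one, one_mul]

theorem laguerreLinear_mem {n : ℕ} (hn : 1 ≤ n)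
    (g : Lp ℂ 2 ((volume : Measure (Fin n → ℂ)).prod (volume : Measure ℝ))) :
    laguerreLinear hn g ∈ L2FanZero n := by
  change ∀ᵐ a ∂(fanMeasure n), fanRepro a (fun w => laguerreLinear hn g (a, w)) =ᵐ[volume]
    fun z => laguerreLinear hn g (a, z)
  filter_upwards [ae_fan_ne_zero n, Measure.ae_ae_of_ae_prod (coeFn_laguerreLinear hn g),
    fanMeasure_ae_of_ae n (ae_memLp_slice (Lp.stronglyMeasurable g) (Lp.memLp g))] with a h0 h1 h2
  filter_upwards [h1] with z hz
  rw [fanRepro_congr a h1 z, hz]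
  have hpos : 0 < |a.1.1| := abs_pos.2 h0
  have hC : (((2 * Real.pi / |a.1.1|) ^ n : ℝ) : ℂ) ≠ 0 := by
    exact_mod_cast (by positivity : (0 : ℝ) < (2 * Real.pi / |a.1.1|) ^ n).ne'
  refine mul_left_cancel₀ hC ?_
  rw [fanRepro_eq_of_twistedConv h0]
  have := twistedConv_laguerreFun_twistedConv hn h0 h2 (fanIndex a) (fanIndex a) z
  rw [if_pos rfl] at this
  exact this

/-- The condition is indexed by `λ` rather than by points of the fan because it is needed at the
point of `R_k` above `λ` while the transform is evaluated on another ray. -/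
theorem ae_fan_slice_eq {n : ℕ} {F : L2Fan n} (hF : F ∈ L2FanZero n) (k : ℕ) :
    ∀ᵐ lam : ℝ, MemLp (fun z => F (fanPoint n k lam, z)) 2 volume ∧
      fanRepro (fanPoint n k lam) (fun w => F (fanPoint n k lam, w)) =ᵐ[volume]
        fun z => F (fanPoint n k lam, z) :=
  (ae_fanPoint_of_ae (memLp_slice F) k).and
    (ae_fanPoint_of_ae (P := fun a => fanRepro a (fun w => F (a, w)) =ᵐ[volume]
      fun z => F (a, z)) hF k)

/-- The function on `ℂⁿ × ℝ` whose Laguerre expansion is the restriction of `F` to the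
ray `R_k`. -/
noncomputable def rayPart {n : ℕ} (F : heisFan n × (Fin n → ℂ) → ℂ) (k : ℕ)
    (p : (Fin n → ℂ) × ℝ) : ℂ :=
  ((|p.2| / (2 * Real.pi)) ^ n : ℝ) * F (fanPoint n k p.2, p.1)

theorem stronglyMeasurable_rayPart {n : ℕ} {F : heisFan n × (Fin n → ℂ) → ℂ}
    (hF : StronglyMeasurable F) (k : ℕ) : StronglyMeasurable (rayPart F k) := by
  have h1 : Measurable fun p : (Fin n → ℂ) × ℝ => (((|p.2| / (2 * Real.pi)) ^ n : ℝ) : ℂ) := by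
    fun_prop
  have h2 : StronglyMeasurable fun p : (Fin n → ℂ) × ℝ => F (fanPoint n k p.2, p.1) :=
    hF.comp_measurable (((measurable_fanPoint n k).comp measurable_snd).prodMk measurable_fst)
  exact h1.stronglyMeasurable.mul h2

/-- The weight `(|λ|/2π)^n` matches the density of `ν` up to a constant, and one ray contributes at
most the sum over all rays. -/
theorem memLp_rayPart {n : ℕ} (F : L2Fan n) (k : ℕ) :
    MemLp (rayPart (n := n) F k) 2 (volume.prod volume) := by
  have hFm := Lp.stronglyMeasurable F
  have hm := stronglyMeasurable_rayPart hFm k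
  rw [memLp_two_iff_lintegral hm.aestronglyMeasurable,
    lintegral_prod_symm _ (hm.measurable.enorm.pow_const 2).aemeasurable]
  have hFlt := (memLp_two_iff_lintegral (Lp.memLp F).1).1 (Lp.memLp F)
  rw [lintegral_fanMeasure_prod n (hFm.measurable.enorm.pow_const 2)] at hFlt
  have hc : ENNReal.ofReal (((2 * Real.pi) ^ (2 * n + 1))⁻¹) ≠ 0 :=
    (ENNReal.ofReal_pos.2 (by positivity)).ne'
  have hlt := (ENNReal.lt_top_of_mul_ne_top_right hFlt.ne hc)
  have hle : ∀ lam : ℝ, ∫⁻ w, ‖rayPart (n := n) F k (w, lam)‖ₑ ^ 2 ≤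
      ENNReal.ofReal (((2 * Real.pi) ^ (2 * n))⁻¹) *
      ((∑' j : ℕ, ∫⁻ z, ‖F (fanPoint n j lam, z)‖ₑ ^ 2) * ENNReal.ofReal (|lam| ^ (2 * n))) := by
    intro lam
    have e : ∀ w, ‖rayPart (n := n) F k (w, lam)‖ₑ ^ 2 =
        ENNReal.ofReal (((2 * Real.pi) ^ (2 * n))⁻¹ * |lam| ^ (2 * n)) *
          ‖F (fanPoint n k lam, w)‖ₑ ^ 2 := by
      intro w
      rw [rayPart, enorm_mul, mul_pow]
      congr 1
      rw [← ofReal_norm, Complex.norm_real, Real.norm_of_nonneg (by positivity),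
        ← ENNReal.ofReal_pow (by positivity)]
      congr 1
      rw [← pow_mul, div_pow, mul_comm n 2]
      field_simp
    simp_rw [e]
    rw [lintegral_const_mul' _ _ ENNReal.ofReal_ne_top, ENNReal.ofReal_mul (by positivity),
      mul_assoc, mul_comm (ENNReal.ofReal (|lam| ^ (2 * n)))]
    gcongr
    exact ENNReal.le_tsum k
  refine (lintegral_mono hle).trans_lt ?_
  rw [lintegral_const_mul' _ _ ENNReal.ofReal_ne_top]
  exact ENNReal.mul_lt_top ENNReal.ofReal_lt_top hlt

/-- On `R_k` the slice of `F` is fixed by the `k`-th projection. Convolution with `φ_{j,λ}`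
therefore annihilates it for `j ≠ k` and multiplies it by `(2π/|λ|)^n` for `j = k`, which the weight
in `rayPart` cancels. -/
theorem laguerreLinear_rayPart {n : ℕ} (hn : 1 ≤ n) {F : L2Fan n} (hF : F ∈ L2FanZero n) (k : ℕ) :
    laguerreLinear hn ((memLp_rayPart F k).toLp _) =ᵐ[(fanMeasure n).prod volume]
      {p | fanIndex p.1 = k}.indicator F := by
  refine (coeFn_laguerreLinear hn _).trans
    ((laguerreTransform_congr (memLp_rayPart F k).coeFn_toLp).trans ?_)
  have hm1 := (stronglyMeasurable_laguerreTransform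
    (stronglyMeasurable_rayPart (Lp.stronglyMeasurable F) k)).measurable
  have hms : MeasurableSet {p : heisFan n × (Fin n → ℂ) | fanIndex p.1 = k} :=
    (measurable_fanIndex.comp measurable_fst) (measurableSet_singleton k)
  have hm2 := ((Lp.stronglyMeasurable F).indicator hms).measurable
  refine (Measure.ae_prod_iff_ae_ae (measurableSet_eq_fun hm1 hm2)).2 ?_
  filter_upwards [ae_fan_ne_zero n, fanMeasure_ae_of_ae n (ae_fan_slice_eq hF k)] with a h0 ha
  obtain ⟨hL, hR⟩ := ha
  have hpos : 0 < |a.1.1| := abs_pos.2 h0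
  set C : ℂ := (((2 * Real.pi / |a.1.1|) ^ n : ℝ) : ℂ) with hCdef
  have hC : C ≠ 0 := by
    rw [hCdef]
    exact_mod_cast (by positivity : (0 : ℝ) < (2 * Real.pi / |a.1.1|) ^ n).ne'
  have hCi : (((|a.1.1| / (2 * Real.pi)) ^ n : ℝ) : ℂ) = C⁻¹ := by
    rw [hCdef, ← Complex.ofReal_inv, ← inv_pow, inv_div]
  have hfk : (fanPoint n k a.1.1).1.1 ≠ 0 := h0
  have hR2 : (fun z => F (fanPoint n k a.1.1, z)) =ᵐ[volume] fun z => C⁻¹ *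
      twistedConv a.1.1 (fun w => (laguerreFun n k a.1.1 w : ℂ))
        (fun z => F (fanPoint n k a.1.1, z)) z := by
    filter_upwards [hR] with z hz
    have h1 := fanRepro_eq_of_twistedConv hfk (fun w => F (fanPoint n k a.1.1, w)) z
    rw [hz, fanIndex_fanPoint n k h0] at h1
    rw [eq_inv_mul_iff_mul_eq₀ hC]
    exact h1
  have hT : ∀ z, laguerreTransform (rayPart (n := n) F k) (a, z) =
      if fanIndex a = k then C⁻¹ * twistedConv a.1.1 (fun w => (laguerreFun n k a.1.1 w : ℂ))
        (fun z => F (fanPoint n k a.1.1, z)) z else 0 := by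
    intro z
    rw [laguerreTransform]
    simp only [rayPart]
    rw [twistedConv_const_mul_right, hCi, twistedConv_congr _ _ hR2, twistedConv_const_mul_right,
      twistedConv_laguerreFun_twistedConv hn h0 hL]
    split_ifs
    · rw [← hCdef, inv_mul_cancel_left₀ hC]
    · simp
  filter_upwards [hR2] with z hz
  rw [hT, Set.indicator_apply]
  simp only [Set.mem_ofPred_eq]
  split_ifs with hk
  · rw [← hz, ← hk, eq_fanPoint_fanIndex h0]
  · rfl

/-- The fibrewise Laguerre expansion as a continuous linear map. -/
noncomputable def laguerreL2 {n : ℕ} (hn : 1 ≤ n) :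
    Lp ℂ 2 ((volume : Measure (Fin n → ℂ)).prod (volume : Measure ℝ)) →L[ℂ] L2Fan n :=
  (laguerreLinear hn).mkContinuous (√(2 * Real.pi))⁻¹ fun g => (norm_laguerreLinear hn g).le

theorem exists_laguerreL2_eq {n : ℕ} (hn : 1 ≤ n) {F : L2Fan n} (hF : F ∈ L2FanZero n) :
    ∃ g, laguerreL2 hn g = F := by
  refine surjective_of_orthogonal_range (laguerreL2 hn) (c := (√(2 * Real.pi))⁻¹) (by positivity)
    (norm_laguerreLinear hn) fun G hG => ?_
  have hms : ∀ k, MeasurableSet {p : heisFan n × (Fin n → ℂ) | fanIndex p.1 = k} := fun k =>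
    (measurable_fanIndex.comp measurable_fst) (measurableSet_singleton k)
  -- Orthogonality to the range includes orthogonality to each restriction of `F` to the points of
  -- index `k`; these sets partition the fan.
  have hk : ∀ k, ∫ p in {p : heisFan n × (Fin n → ℂ) | fanIndex p.1 = k}, inner ℂ (F p) (G p)
      ∂((fanMeasure n).prod volume) = 0 := by
    intro k
    have h1 : inner ℂ (laguerreLinear hn ((memLp_rayPart F k).toLp _)) G = 0 := hG _
    rw [L2.inner_def] at h1
    rw [← h1, ← integral_indicator (hms k)]
    refine integral_congr_ae ?_
    filter_upwards [laguerreLinear_rayPart hn hF k] with p hp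
    rw [hp, Set.indicator_apply, Set.indicator_apply]
    split_ifs
    · rfl
    · rw [inner_zero_left]
  rw [L2.inner_def]
  have hU : (⋃ k, {p : heisFan n × (Fin n → ℂ) | fanIndex p.1 = k}) = Set.univ :=
    Set.eq_univ_of_forall fun p => Set.mem_iUnion.2 ⟨fanIndex p.1, rfl⟩
  rw [← setIntegral_univ, ← hU, integral_iUnion hms]
  · simp only [hk, tsum_zero]
  · intro i j hij
    refine Set.disjoint_left.2 fun p hp1 hp2 => hij ?_
    exact hp1.symm.trans hp2
  · exact (L2.integrable_inner F G).integrableOn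

/-! ### Identification with the Strichartz transform and conclusion. -/

/-- Since `(w,s)⁻¹(z,0) = (z - w, -s + ½ Im(z · w̄))`, the exponential splits into the Fourier
kernel in `s` and the twist in `w`. Boundedness of `e_{k,λ}` and integrability of `f` justify
Fubini. -/
theorem strichartzFT_eq_laguerreTransform {n : ℕ} (hn : 1 ≤ n) {f : Heis n → ℂ}
    (hf : Integrable f volume) {a : heisFan n} (ha : a.1.1 ≠ 0) (z : Fin n → ℂ) :
    strichartzFT n f a z = laguerreTransform (fiberFT f) (a, z) := by
  set lam := a.1.1
  set k := fanIndex a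
  have hcont : Continuous fun p : Heis n => heisE n k lam (heisMul (heisInv p) (z, 0)) := by
    unfold heisE laguerreFun laguerreL normSqC heisMul heisInv imDot
    fun_prop
  have hbd : ∀ p : Heis n, ‖heisE n k lam (heisMul (heisInv p) (z, 0))‖ ≤ 4 ^ k * (4 / 3) ^ n := by
    intro p
    have h1 := norm_laguerreFun_le hn k lam (heisMul (heisInv p) (z, 0)).1
    have h2 := normSqC_nonneg (heisMul (heisInv p) (z, 0)).1
    have h3 : ‖Complex.exp (Complex.I * lam * (heisMul (heisInv p) (z, 0)).2)‖ = 1 := by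
      rw [Complex.norm_exp]
      simp
    rw [heisE, norm_mul, h3, one_mul]
    refine h1.trans ?_
    have h4 : Real.exp (-(|lam| / 12 * normSqC (heisMul (heisInv p) (z, 0)).1)) ≤ 1 :=
      Real.exp_le_one_iff.2 (neg_nonpos.2 (by positivity))
    gcongr
    exact mul_le_of_le_one_right (by positivity) h4
  have hI : Integrable (fun p : Heis n => f p * heisE n k lam (heisMul (heisInv p) (z, 0)))
      (volume.prod volume) :=
    hf.mul_bdd hcont.aestronglyMeasurable (.of_forall hbd)
  rw [strichartzFT, if_pos ha, laguerreTransform, twistedConv]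
  change ∫ p : Heis n, f p * heisE n k lam (heisMul (heisInv p) (z, 0)) ∂(volume.prod volume) = _
  rw [integral_prod _ hI]
  refine integral_congr_ae (.of_forall fun w => ?_)
  simp only [fiberFT, spectralFT]
  rw [← integral_const_mul, ← integral_mul_const]
  refine integral_congr_ae (.of_forall fun s => ?_)
  have him : imDot (-w) z = imDot z w := by
    have h1 := imDot_sub_left (0 : Fin n → ℂ) w z
    have h2 : imDot (0 : Fin n → ℂ) z = 0 := by simp [imDot]
    rw [zero_sub, h2, zero_sub, imDot_swap z w, neg_neg] at h1
    exact h1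
  simp only [heisE, heisMul, heisInv, him, neg_add_eq_sub w z]
  have he : Complex.exp (Complex.I * lam * ((-s + 0 + 1 / 2 * imDot z w : ℝ) : ℂ)) =
      Complex.exp (-(Complex.I * lam * s)) * Complex.exp (Complex.I / 2 * lam * imDot z w) := by
    rw [← Complex.exp_add]
    congr 1
    push_cast
    ring
  rw [he]
  ring

/-- The Strichartz Fourier transform on `L²(ℍⁿ)`. -/
noncomputable def strichartzL2 {n : ℕ} (hn : 1 ≤ n) : L2Heis n →ₗᵢ[ℂ] L2FanZero n where
  toLinearMap := LinearMap.codRestrict (L2FanZero n)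
    ((laguerreLinear hn).comp (fiberFTL (volume : Measure (Fin n → ℂ))).toLinearMap)
    fun f => laguerreLinear_mem hn (fiberFTL volume f)
  norm_map' f := by
    change ‖laguerreLinear hn (fiberFTL (volume : Measure (Fin n → ℂ)) f)‖ = ‖f‖
    rw [norm_laguerreLinear]
    have h := norm_fiberFTL (μ := (volume : Measure (Fin n → ℂ))) f
    rw [h, inv_mul_cancel_left₀ (by positivity)]

theorem strichartzL2_apply {n : ℕ} (hn : 1 ≤ n) (f : L2Heis n) :
    (strichartzL2 hn f : L2Fan n) =
      laguerreLinear hn (fiberFTL (volume : Measure (Fin n → ℂ)) f) := rfl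

theorem strichartzL2_surjective {n : ℕ} (hn : 1 ≤ n) : Function.Surjective (strichartzL2 hn) := by
  rintro ⟨F, hF⟩
  obtain ⟨g, hg⟩ := exists_laguerreL2_eq hn hF
  obtain ⟨f, hf⟩ := fiberFTL_surjective (μ := (volume : Measure (Fin n → ℂ))) g
  refine ⟨f, Subtype.ext ?_⟩
  rw [strichartzL2_apply]
  have h2 : laguerreLinear hn g = F := hg
  exact (congrArg (laguerreLinear hn) hf).trans h2

theorem isClosed_L2FanZero {n : ℕ} (hn : 1 ≤ n) : IsClosed (L2FanZero n : Set (L2Fan n)) := by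
  have h : (L2FanZero n : Set (L2Fan n)) = Set.range (laguerreL2 hn) := by
    ext F
    constructor
    · exact fun hF => exists_laguerreL2_eq hn hF
    · rintro ⟨g, rfl⟩
      exact laguerreLinear_mem hn g
  rw [h]
  exact isClosed_range_of_norm_eq (laguerreL2 hn) (c := (√(2 * Real.pi))⁻¹) (by positivity)
    (norm_laguerreLinear hn)

theorem theorem1p3 (n : ℕ) (hn : 1 ≤ n) :
    IsClosed (L2FanZero n : Set (L2Fan n)) ∧
    ∃ U : L2Heis n ≃ₗᵢ[ℂ] L2FanZero n,
      ∀ (f : Heis n → ℂ) (_ : Integrable f volume) (hf₂ : MemLp f 2 volume),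
        ((U (hf₂.toLp f) : L2Fan n) : heisFan n × (Fin n → ℂ) → ℂ)
          =ᵐ[(fanMeasure n).prod volume] fun p => strichartzFT n f p.1 p.2 := by
  refine ⟨isClosed_L2FanZero hn,
    LinearIsometryEquiv.ofSurjective (strichartzL2 hn) (strichartzL2_surjective hn),
    fun f hf₁ hf₂ => ?_⟩
  have h1 : fiberFTL (volume : Measure (Fin n → ℂ)) (hf₂.toLp f)
      =ᵐ[volume.prod volume] fiberFT f := fiberFTL_toLp hf₁ hf₂
  have h2 := (coeFn_laguerreLinear hn
    (fiberFTL (volume : Measure (Fin n → ℂ)) (hf₂.toLp f))).trans (laguerreTransform_congr h1)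
  -- The fibre `λ = 0` is `ν`-null, so the formulas for the limiting ray are never used.
  filter_upwards [h2, fanMeasure_prod_ae (ae_fan_ne_zero n)] with p hp h0
  rw [strichartzFT_eq_laguerreTransform hn hf₁ h0]
  exact hp
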